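/- **Setting.** Let $\nu$ be a probability law on $\mathbb{R}$ with mean zero and positive variance such that, for some $\alpha>0$, $\int e^{\lambda u}\,d\nu(u)<\infty$ for all $|\lambda|<1/\alpha$. Its $\psi_1$-norm is $\|\nu\|_{\psi_1}=\inf\{s>0:\int e^{|u|/s}\,d\nu(u)\le 2\}$. The *constant regression model* with noise law $\nu$, sample size $n$ and $p\ge 1$ covariates consists of i.i.d. pairs $\mathcal{D}=\{(y_i,\mathbf{x}_i):1\le i\le n\}$, $\mathbf{x}_i=(x_{i1},\dots,x_{ip})\in\mathbb{R}^p$, with $y_i=\mu+\varepsilon_i$, where $\mu\in\mathbb{R}$ is a constant, $\varepsilon_i$ has law $\nu$ and is independent of $\mathbf{x}_i$, and the coordinates $x_{i1},\dots,x_{ip}$ are independent with continuous distributions. Let $F_{\mathbf{X}}$ denote the law of $\mathbf{x}_i$. A (possibly non-maximal) *CART tree of depth $K$* built on $\mathcal{D}$ is a binary tree with at most $K$ levels of splits, starting from the root node $\mathbb{R}^p$, in which every split of a node $\mathsf{t}$ into $\mathsf{t}\cap\{x_j\le\varsigma\}$ and $\mathsf{t}\cap\{x_j>\varsigma\}$ is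 proper (both children contain a data point), and $(j,\varsigma)$, together with suitable $\beta_{\mathtt L},\beta_{\mathtt R}$, minimizes $$\sum_{i:\mathbf{x}_i\in\mathsf{t}}\big(y_i-\beta_{\mathtt L}\mathbb{1}(x_{ij}\le\varsigma)-\beta_{\mathtt R}\mathbb{1}(x_{ij}>\varsigma)\big)^2$$ over all $1\le j\le p$ and $\varsigma,\beta_{\mathtt L},\beta_{\mathtt R}\in\mathbb{R}$. Ties may be resolved in any (measurable) way and any node may be left unsplit. The CART estimator without sample splitting, $\hat\mu^{\mathtt{NSS}}(\mathbf{x})$, is the average of the $y_i$ with $\mathbf{x}_i$ in the terminal node containing $\mathbf{x}$, the same data $\mathcal{D}$ being used to build the tree and to average. **Theorem ($L_2$ consistency, no sample splitting).** Consider the constant regression model with noise law $\nu$ and a CART tree of depth $K$ built on the full sample $\mathcal{D}$. 1. For all $n\ge 2$, $p\ge 1$ and $K\ge 0$, $$\mathbb{E}\bigg[\int\big(\hat\mu^{\mathtt{NSS}}(\mathbf{x})-\mu\big)^2\,dF_{\mathbf{X}}(\mathbf{x})\bigg]\le C\,\frac{2^K\log(n)^4\log(np)}{n},$$ where the expectation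 is finite and $C$ is a positive constant that depends only on $\|\nu\|_{\psi_1}$. 2. There is a positive constant $C'$ depending only on the noise law $\nu$ such that, for every sequence of such models and trees indexed by the sample size $n$ (where $p$, $K$, $\mu$ and $F_{\mathbf{X}}$ may vary with $n$), $$\limsup_{n\to\infty}\mathbb{P}\bigg(\int\big(\hat\mu^{\mathtt{NSS}}(\mathbf{x})-\mu\big)^2\,dF_{\mathbf{X}}(\mathbf{x})\ge C'\,\frac{2^K\log(n)^4\log(np)}{n}\bigg)=0.$$ -/

import Mathlib

open MeasureTheory ProbabilityTheory Filter

universe u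

noncomputable section

/-- A binary tree of axis-parallel splits of `ℝ^p`. A node `node j s L R` sends the points with
`x j ≤ s` to the left child `L` and the points with `x j > s` to the right child `R`. -/
inductive CartTree (p : ℕ) : Type where
  | leaf : CartTree p
  | node (j : Fin p) (s : ℝ) (L R : CartTree p) : CartTree p

/-- A data set of size `n`: pairs (outcome, covariate vector). -/
abbrev Dataset (n p : ℕ) : Type := Fin n → ℝ × (Fin p → ℝ)

namespace CartTree

variable {p : ℕ}

/-- The number of levels of splits on the longest root-to-leaf path. -/
def depth : CartTree p → ℕ
  | leaf => 0
  | node _ _ L R => max L.depth R.depth + 1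

/-- The terminal region containing `x` when the tree is grown from the region `t`. -/
def cellFrom : CartTree p → Set (Fin p → ℝ) → (Fin p → ℝ) → Set (Fin p → ℝ)
  | leaf, t, _ => t
  | node j s L R, t, x =>
      if x j ≤ s then L.cellFrom (t ∩ {u | u j ≤ s}) x
      else R.cellFrom (t ∩ {u | s < u j}) x

/-- The terminal node (cell of the partition) of the tree that contains `x`. -/
def cell (T : CartTree p) (x : Fin p → ℝ) : Set (Fin p → ℝ) := T.cellFrom Set.univ x

end CartTree

open Classical in
/-- The indices of the data points whose covariates lie in the region `t`. -/
def nodePoints {n p : ℕ} (D : Dataset n p) (t : Set (Fin p → ℝ)) : Finset (Fin n) :=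
  Finset.univ.filter fun i => (D i).2 ∈ t

/-- The CART estimate: the average outcome over the data points in the terminal node of `x`
(and `0` if that node contains no data point). -/
def cartEstimate {n p : ℕ} (T : CartTree p) (D : Dataset n p) (x : Fin p → ℝ) : ℝ :=
  if (nodePoints D (T.cell x)).card = 0 then 0
  else (∑ i ∈ nodePoints D (T.cell x), (D i).1) / ((nodePoints D (T.cell x)).card : ℝ)

/-- The sum of squared errors, within the region `t`, of splitting along coordinate `j` at `s`
with outputs `βL` and `βR`. -/
def splitSSE {n p : ℕ} (D : Dataset n p) (t : Set (Fin p → ℝ)) (j : Fin p) (s βL βR : ℝ) : ℝ :=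
  ∑ i ∈ nodePoints D t, ((D i).1 - (if (D i).2 j ≤ s then βL else βR)) ^ 2

/-- `(j, s)` is an SSE-minimizing split of the region `t`: with suitable outputs it attains the
minimum over all coordinates, all split points and all pairs of outputs. -/
def IsSSESplit {n p : ℕ} (D : Dataset n p) (t : Set (Fin p → ℝ)) (j : Fin p) (s : ℝ) : Prop :=
  ∃ βL βR : ℝ, ∀ (j' : Fin p) (s' βL' βR' : ℝ),
    splitSSE D t j s βL βR ≤ splitSSE D t j' s' βL' βR'

/-- The tree, started at the region `t`, is grown by the CART procedure on the data `D`: every split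
is a proper one (both children contain data points) and minimizes the sum of squared errors.
Ties may be resolved in any way, and any node may be left unsplit. -/
def CartTree.GrownFrom {n p : ℕ} (D : Dataset n p) : CartTree p → Set (Fin p → ℝ) → Prop
  | .leaf, _ => True
  | .node j s L R, t =>
      (nodePoints D (t ∩ {u | u j ≤ s})).Nonempty ∧
      (nodePoints D (t ∩ {u | s < u j})).Nonempty ∧
      IsSSESplit D t j s ∧
      L.GrownFrom D (t ∩ {u | u j ≤ s}) ∧
      R.GrownFrom D (t ∩ {u | s < u j})

/-- `T` is a (possibly non-maximal) CART tree of depth `K` constructed from the data `D`. -/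
def IsCartTree {n p : ℕ} (K : ℕ) (D : Dataset n p) (T : CartTree p) : Prop :=
  T.depth ≤ K ∧ T.GrownFrom D Set.univ

/-- Conditions on the law `ν` of the noise: centred, of positive variance, with a moment generating
function that is finite on a neighbourhood of zero. -/
structure IsNoiseLaw (ν : Measure ℝ) : Prop where
  isProbabilityMeasure : IsProbabilityMeasure ν
  mean_zero : ∫ e, e ∂ν = 0
  variance_pos : 0 < ∫ e, e ^ 2 ∂ν
  exp_moment : ∃ α : ℝ, 0 < α ∧
    ∀ l : ℝ, |l| < 1 / α → Integrable (fun e : ℝ => Real.exp (l * e)) ν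

/-- The sub-exponential (Orlicz `ψ₁`) norm `inf {s > 0 : E exp(|e| / s) ≤ 2}` of a law on `ℝ`. -/
def psiOneNorm (ν : Measure ℝ) : ℝ :=
  sInf {s : ℝ | 0 < s ∧ ∫⁻ e, ENNReal.ofReal (Real.exp (|e| / s)) ∂ν ≤ 2}

/-- The constant regression model: the `(y i, X i)` are i.i.d. with `y i = c + ε i`, where `X i` has
law `PX` and independent, continuously distributed coordinates, and where `ε i` is independent
of `X i` and has law `ν`. -/
structure IsLocationModel {Ω : Type*} [MeasurableSpace Ω] (P : Measure Ω) {n p : ℕ}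
    (X : Fin n → Ω → (Fin p → ℝ)) (ε y : Fin n → Ω → ℝ) (c : ℝ)
    (PX : Measure (Fin p → ℝ)) (ν : Measure ℝ) : Prop where
  isProbabilityMeasure : IsProbabilityMeasure P
  measurable_X : ∀ i, Measurable (X i)
  measurable_noise : ∀ i, Measurable (ε i)
  outcome : ∀ i ω, y i ω = c + ε i ω
  indep_sample : iIndepFun (fun i ω => (y i ω, X i ω)) P
  law_X : ∀ i, P.map (X i) = PX
  law_noise : ∀ i, P.map (ε i) = ν
  indep_noise : ∀ i, IndepFun (X i) (ε i) P
  isProbabilityMeasure_PX : IsProbabilityMeasure PX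
  indep_coordinates : iIndepFun (fun (j : Fin p) (x : Fin p → ℝ) => x j) PX
  continuous_coordinates : ∀ (j : Fin p) (t : ℝ), PX {x | x j = t} = 0

/-- The observed data set. -/
def sample {Ω : Type*} {n p : ℕ} (X : Fin n → Ω → (Fin p → ℝ)) (y : Fin n → Ω → ℝ) (ω : Ω) :
    Dataset n p := fun i => (y i ω, X i ω)

/-- `T` is a random tree that almost surely is a depth-`K` CART tree built from the full data set.
The estimator that averages the same data over its cells is required to be (jointly) measurable. -/
structure IsNSSCart {Ω : Type*} [MeasurableSpace Ω] (P : Measure Ω) {n p : ℕ} (K : ℕ)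
    (X : Fin n → Ω → (Fin p → ℝ)) (y : Fin n → Ω → ℝ) (T : Ω → CartTree p) : Prop where
  isCartTree : ∀ᵐ ω ∂P, IsCartTree K (sample X y ω) (T ω)
  measurable_estimate :
    Measurable fun q : Ω × (Fin p → ℝ) => cartEstimate (T q.1) (sample X y q.1) q.2

/-- The integrated squared error, under the covariate law `PX`, of the CART estimator without sample
splitting (the same data build the tree `T ω` and are averaged over its cells). -/
def nssError {Ω : Type*} {n p : ℕ} (X : Fin n → Ω → (Fin p → ℝ)) (y : Fin n → Ω → ℝ)
    (T : Ω → CartTree p) (c : ℝ) (PX : Measure (Fin p → ℝ)) (ω : Ω) : ℝ :=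
  ∫ x, (cartEstimate (T ω) (sample X y ω) x - c) ^ 2 ∂PX

/-- The rate `2^K log(n)^4 log(np) / n`. -/
def cartRate (n p K : ℕ) : ℝ :=
  2 ^ K * Real.log (n : ℝ) ^ 4 * Real.log ((n : ℝ) * (p : ℝ)) / (n : ℝ)

end

/-! On a cell containing $N$ data points, the error of the estimator is the mean of the noise over
those points. The integrated error is therefore a sum, over at most $2^K$ cells, of (mass of the
cell) × (mean noise)², and it is enough to bound one such term uniformly over all boxes cut out by
$K$ half-spaces that contain a data point.

Uniformity replaces sample splitting. Given the covariates, such a box meets the sample in one of at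
most $(1+2pn)^K$ index sets (`exists_nodePoints_eq_traceBox`). This list depends on the covariates
only, so it is independent of the noise even though the tree is not. With $L=(K+1)\log(1+2pn)$, a
union bound in exponential-moment form controls all noise sums at once: $\mathbb
E\sup(\sum_S\varepsilon)^2/|S|\lesssim L\log^2 n$ (`sq_sum_div_card_le`, `noiseBound_bound`). A
relative Chernoff bound over boxes with quantile thresholds shows that the mass of a box is at most
$2N/n$ plus an excess of mean $O(L/n)$ (`measureReal_halfBox_le`, `massExcess_bound`). The part
$2N/n$ is paired with the noise sums. The excess is paired with the largest squared noise, which is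
independent of it.

The expected error is thus $O(2^K L\log^2 n/n)$ (`treeErrorBound_bound`). If $2^K<n$, then
$K\lesssim\log n$ and this is $O(2^K\log^3 n\,\log(np)/n)$; if $2^K\ge n$, the largest squared noise
alone is small enough. A factor $\log n$ is left over, so the expectation bound also yields the
probability statement, by Markov's inequality. -/

open scoped ENNReal

noncomputable section

/-! ### Cells as boxes, and the finitely many traces of boxes on the sample. -/

section Trees

variable {n p : ℕ}

/-- The half-space `{u | u j ≤ s}` (for `true`) or `{u | s < u j}` (for `false`); the whole space
for `none`. -/
def halfSpace : Option (Fin p × Bool × ℝ) → Set (Fin p → ℝ)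
  | none => Set.univ
  | some (j, true, s) => {u | u j ≤ s}
  | some (j, false, s) => {u | s < u j}

/-- The box cut out by `K` half-spaces. -/
def halfBox {K : ℕ} (f : Fin K → Option (Fin p × Bool × ℝ)) : Set (Fin p → ℝ) :=
  {u | ∀ k, u ∈ halfSpace (f k)}

lemma measurableSet_halfSpace (h : Option (Fin p × Bool × ℝ)) : MeasurableSet (halfSpace h) := by
  rcases h with _ | ⟨j, _ | _, s⟩
  · exact MeasurableSet.univ
  · exact measurableSet_lt measurable_const (measurable_pi_apply j)
  · exact measurableSet_le (measurable_pi_apply j) measurable_const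

lemma measurableSet_halfBox {K : ℕ} (f : Fin K → Option (Fin p × Bool × ℝ)) :
    MeasurableSet (halfBox f) := by
  simp only [halfBox, Set.ofPred_forall]
  exact MeasurableSet.iInter fun k => measurableSet_halfSpace (f k)

lemma halfBox_cons {K : ℕ} (h : Option (Fin p × Bool × ℝ))
    (f : Fin K → Option (Fin p × Bool × ℝ)) :
    halfBox (Fin.cons h f : Fin (K + 1) → Option (Fin p × Bool × ℝ)) =
      halfSpace h ∩ halfBox f := by
  ext u
  simp [halfBox, Fin.forall_fin_succ]

lemma CartTree.exists_cellFrom_eq (T : CartTree p) (x : Fin p → ℝ) :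
    ∀ (K : ℕ) (t : Set (Fin p → ℝ)), T.depth ≤ K →
      ∃ f : Fin K → Option (Fin p × Bool × ℝ), T.cellFrom t x = t ∩ halfBox f := by
  induction T with
  | leaf =>
    intro K t _
    refine ⟨fun _ => none, ?_⟩
    simp [CartTree.cellFrom, halfBox, halfSpace]
  | node j s L R ihL ihR =>
    intro K t hK
    obtain ⟨K, rfl⟩ : ∃ m, K = m + 1 := ⟨K - 1, by simp only [CartTree.depth] at hK; omega⟩
    simp only [CartTree.depth, add_le_add_iff_right, max_le_iff] at hK
    by_cases hx : x j ≤ s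
    · obtain ⟨f, hf⟩ := ihL K (t ∩ {u | u j ≤ s}) hK.1
      refine ⟨Fin.cons (some (j, true, s)) f, ?_⟩
      rw [halfBox_cons, CartTree.cellFrom, if_pos hx, hf, Set.inter_assoc]
      rfl
    · obtain ⟨f, hf⟩ := ihR K (t ∩ {u | s < u j}) hK.2
      refine ⟨Fin.cons (some (j, false, s)) f, ?_⟩
      rw [halfBox_cons, CartTree.cellFrom, if_neg hx, hf, Set.inter_assoc]
      rfl

lemma CartTree.exists_cell_eq (T : CartTree p) {K : ℕ} (hK : T.depth ≤ K) (x : Fin p → ℝ) :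
    ∃ f : Fin K → Option (Fin p × Bool × ℝ), T.cell x = halfBox f := by
  obtain ⟨f, hf⟩ := T.exists_cellFrom_eq x K Set.univ hK
  exact ⟨f, by rw [CartTree.cell, hf, Set.univ_inter]⟩

lemma CartTree.GrownFrom.nonempty_cellFrom {D : Dataset n p} (x : Fin p → ℝ) {T : CartTree p} :
    ∀ {t : Set (Fin p → ℝ)}, T.GrownFrom D t → (nodePoints D t).Nonempty →
      (nodePoints D (T.cellFrom t x)).Nonempty := by
  induction T with
  | leaf => intro t _ h; exact h
  | node j s L R ihL ihR =>
    intro t h _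
    obtain ⟨hL, hR, _, gL, gR⟩ := h
    rw [CartTree.cellFrom]
    split_ifs with hx
    · exact ihL gL hL
    · exact ihR gR hR

lemma IsCartTree.nonempty_cell {D : Dataset n p} {T : CartTree p} {K : ℕ} (hn : 0 < n)
    (h : IsCartTree K D T) (x : Fin p → ℝ) : (nodePoints D (T.cell x)).Nonempty :=
  h.2.nonempty_cellFrom x ⟨⟨0, hn⟩, by simp [nodePoints]⟩

/-- A function that is constant on the cells of a tree integrates to at most the number of cells
times the largest contribution of one cell. -/
lemma CartTree.setLIntegral_cellFrom_le (μ : Measure (Fin p → ℝ))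
    (φ : Set (Fin p → ℝ) → ℝ≥0∞) (B : ℝ≥0∞) (T : CartTree p) :
    ∀ t : Set (Fin p → ℝ), MeasurableSet t →
      (∀ x ∈ t, μ (T.cellFrom t x) * φ (T.cellFrom t x) ≤ B) →
      ∫⁻ x in t, φ (T.cellFrom t x) ∂μ ≤ 2 ^ T.depth * B := by
  induction T with
  | leaf =>
    intro t _ h
    simp only [CartTree.cellFrom, CartTree.depth, pow_zero, one_mul, lintegral_const,
      Measure.restrict_apply MeasurableSet.univ, Set.univ_inter] at h ⊢
    rcases t.eq_empty_or_nonempty with rfl | ⟨x, hx⟩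
    · simp
    · rw [mul_comm]; exact h x hx
  | node j s L R ihL ihR =>
    intro t ht h
    have hA : MeasurableSet {u : Fin p → ℝ | u j ≤ s} :=
      measurableSet_le (measurable_pi_apply j) measurable_const
    have hdiff : t \ {u : Fin p → ℝ | u j ≤ s} = t ∩ {u | s < u j} := by
      ext u; simp
    have hA' : MeasurableSet {u : Fin p → ℝ | s < u j} :=
      measurableSet_lt measurable_const (measurable_pi_apply j)
    rw [← lintegral_inter_add_sdiff _ t hA, hdiff]
    have eL : ∀ x ∈ t ∩ {u : Fin p → ℝ | u j ≤ s},
        (node j s L R).cellFrom t x = L.cellFrom (t ∩ {u | u j ≤ s}) x := by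
      intro x hx
      rw [CartTree.cellFrom, if_pos (show x j ≤ s from hx.2)]
    have eR : ∀ x ∈ t ∩ {u : Fin p → ℝ | s < u j},
        (node j s L R).cellFrom t x = R.cellFrom (t ∩ {u | s < u j}) x := by
      intro x hx
      rw [CartTree.cellFrom, if_neg (not_le.2 (show s < x j from hx.2))]
    rw [setLIntegral_congr_fun (ht.inter hA) fun x hx => congrArg φ (eL x hx),
      setLIntegral_congr_fun (ht.inter hA') fun x hx => congrArg φ (eR x hx)]
    have h1 := ihL _ (ht.inter hA) fun x hx => by rw [← eL x hx]; exact h x hx.1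
    have h2 := ihR _ (ht.inter hA') fun x hx => by rw [← eR x hx]; exact h x hx.1
    calc _ ≤ 2 ^ L.depth * B + 2 ^ R.depth * B := add_le_add h1 h2
      _ ≤ 2 ^ (max L.depth R.depth) * B + 2 ^ (max L.depth R.depth) * B := by
        gcongr
        · exact one_le_two
        · exact le_max_left _ _
        · exact one_le_two
        · exact le_max_right _ _
      _ = _ := by rw [CartTree.depth, pow_succ]; ring

/-- The data indices in a half-space whose threshold is a data point. -/
def traceHalf (x : Fin n → Fin p → ℝ) : Option (Fin p × Bool × Fin n) → Set (Fin n)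
  | none => Set.univ
  | some (j, true, l) => {i | x i j ≤ x l j}
  | some (j, false, l) => {i | x l j ≤ x i j}

open Classical in
/-- The data indices in a box whose thresholds are data points. -/
def traceBox {K : ℕ} (x : Fin n → Fin p → ℝ) (f : Fin K → Option (Fin p × Bool × Fin n)) :
    Finset (Fin n) :=
  Finset.univ.filter fun i => ∀ k, i ∈ traceHalf x (f k)

/-- The threshold is moved to the extreme data point inside the half-space. This is why both
directions of `traceHalf` are closed and why some data point must lie in the half-space. -/
lemma exists_traceHalf_eq (x : Fin n → Fin p → ℝ) (h : Option (Fin p × Bool × ℝ))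
    (hne : ∃ i, x i ∈ halfSpace h) :
    ∃ c, ∀ i, x i ∈ halfSpace h ↔ i ∈ traceHalf x c := by
  classical
  rcases h with _ | ⟨j, _ | _, s⟩
  · exact ⟨none, fun i => by simp [halfSpace, traceHalf]⟩
  · obtain ⟨l, hl, hmin⟩ := Finset.exists_min_image
      (Finset.univ.filter fun i => s < x i j) (fun i => x i j)
      (by obtain ⟨i, hi⟩ := hne; exact ⟨i, by simpa [halfSpace] using hi⟩)
    simp only [Finset.mem_filter, Finset.mem_univ, true_and] at hl hmin
    exact ⟨some (j, false, l), fun i => ⟨fun hi => hmin i hi, fun hi => lt_of_lt_of_le hl hi⟩⟩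
  · obtain ⟨l, hl, hmax⟩ := Finset.exists_max_image
      (Finset.univ.filter fun i => x i j ≤ s) (fun i => x i j)
      (by obtain ⟨i, hi⟩ := hne; exact ⟨i, by simpa [halfSpace] using hi⟩)
    simp only [Finset.mem_filter, Finset.mem_univ, true_and] at hl hmax
    exact ⟨some (j, true, l), fun i => ⟨fun hi => hmax i hi, fun hi => le_trans hi hl⟩⟩

lemma exists_nodePoints_eq_traceBox {K : ℕ} (D : Dataset n p)
    (f : Fin K → Option (Fin p × Bool × ℝ)) (hne : (nodePoints D (halfBox f)).Nonempty) :
    ∃ c : Fin K → Option (Fin p × Bool × Fin n),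
      nodePoints D (halfBox f) = traceBox (fun i => (D i).2) c := by
  classical
  obtain ⟨i, hi⟩ := hne
  have hi' : (D i).2 ∈ halfBox f := by simpa [nodePoints] using hi
  choose c hc using fun k => exists_traceHalf_eq (fun i => (D i).2) (f k) ⟨i, hi' k⟩
  refine ⟨c, ?_⟩
  ext i
  simp only [nodePoints, traceBox, Finset.mem_filter, Finset.mem_univ, true_and]
  exact forall_congr' fun k => hc k i

end Trees

/-! ### Inner approximation of boxes by boxes with quantile thresholds. -/

section Grid

variable {n p : ℕ}

/-- Without atoms the distribution function is continuous, so the intermediate value theorem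
applies. -/
lemma exists_cdf_eq (m : Measure ℝ) [IsProbabilityMeasure m] (h0 : ∀ t, m {t} = 0) {a : ℝ}
    (ha : 0 < a) (ha' : a < 1) : ∃ g, m.real (Set.Iic g) = a := by
  have hcont : Continuous (cdf m) := by
    refine continuous_iff_continuousAt.2 fun t => ?_
    rw [(monotone_cdf m).continuousAt_iff_leftLim_eq_rightLim, StieltjesFunction.rightLim_eq]
    have h1 := (cdf m).measure_singleton t
    rw [measure_cdf, h0] at h1
    have h2 := (ENNReal.ofReal_eq_zero.1 h1.symm)
    have h3 := (monotone_cdf m).leftLim_le (le_refl t)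
    linarith
  obtain ⟨l, hl⟩ := ((tendsto_cdf_atBot m).eventually_lt_const ha).exists
  obtain ⟨r, hr⟩ := ((tendsto_cdf_atTop m).eventually_const_lt ha').exists
  obtain ⟨g, hg⟩ := mem_range_of_exists_le_of_exists_ge hcont ⟨l, hl.le⟩ ⟨r, hr.le⟩
  exact ⟨g, by rw [← cdf_eq_real, hg]⟩

/-- The half-space whose threshold is taken from the grid `g`. -/
def gridHalf (g : Fin p → Fin n → ℝ) (c : Option (Fin p × Bool × Fin n)) :
    Option (Fin p × Bool × ℝ) :=
  c.map fun q => (q.1, q.2.1, g q.1 q.2.2)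

/-- Neighbouring grid quantiles differ by mass $1/n$, so rounding a threshold inwards loses at most
that much. Half-spaces of mass at most $1/n$ may have no grid half-space inside them and are
negligible anyway. -/
lemma exists_inner_gridHalf (hn : 0 < n) (μ : Measure (Fin p → ℝ)) [IsProbabilityMeasure μ]
    (g : Fin p → Fin n → ℝ)
    (hg : ∀ (j : Fin p) (k : Fin n), 0 < (k : ℕ) → μ.real {u | u j ≤ g j k} = (k : ℝ) / n)
    (h : Option (Fin p × Bool × ℝ)) :
    μ.real (halfSpace h) ≤ 1 / n ∨ ∃ c, halfSpace (gridHalf g c) ⊆ halfSpace h ∧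
      μ.real (halfSpace h \ halfSpace (gridHalf g c)) ≤ 1 / n := by
  have hn' : (0 : ℝ) < n := by exact_mod_cast hn
  -- The choice is $k=\lceil nv\rceil-1$. The strict inequality $k/n<v$ lets the order of thresholds
  -- be read off from the order of masses.
  have level : ∀ v : ℝ, v ≤ 1 → 1 / (n : ℝ) < v →
      ∃ k : ℕ, 0 < k ∧ k < n ∧ (k : ℝ) / n < v ∧ v ≤ (k + 1) / n := by
    intro v hv hv'
    have hv0 : 1 < n * v := by rw [div_lt_iff₀ hn'] at hv'; linarith
    have hc1 : 1 < ⌈n * v⌉₊ := Nat.lt_ceil.2 (by simpa using hv0)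
    have hc2 : ⌈n * v⌉₊ ≤ n := Nat.ceil_le.2 (by nlinarith)
    have hc3 := Nat.le_ceil (n * v)
    have hc4 := Nat.ceil_lt_add_one (show 0 ≤ n * v by linarith)
    have hcast : ((⌈n * v⌉₊ - 1 : ℕ) : ℝ) = (⌈n * v⌉₊ : ℝ) - 1 := by
      rw [Nat.cast_sub hc1.le]; simp
    refine ⟨⌈n * v⌉₊ - 1, by omega, by omega, ?_, ?_⟩
    · rw [div_lt_iff₀ hn', hcast]; linarith
    · rw [le_div_iff₀ hn', hcast]; linarith
  by_cases hsmall : μ.real (halfSpace h) ≤ 1 / n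
  · exact Or.inl hsmall
  push Not at hsmall
  right
  obtain ⟨k, hk0, hkn, hk1, hk2⟩ := level _ measureReal_le_one hsmall
  rcases h with _ | ⟨j, _ | _, s⟩
  · exact ⟨none, by simp [gridHalf, halfSpace]⟩
  · have hcompl : ∀ t : ℝ, halfSpace (some (j, false, t)) = (halfSpace (some (j, true, t)))ᶜ := by
      intro t; ext u; simp [halfSpace]
    -- An upper half-space of mass $k/n$ starts at the quantile of level $(n-k)/n$.
    have hkk := hg j ⟨n - k, by omega⟩ (by simp; omega)
    set t := g j ⟨n - k, by omega⟩
    have ht : μ.real (halfSpace (some (j, false, t))) = (k : ℝ) / n := by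
      rw [hcompl, probReal_compl_eq_one_sub (measurableSet_halfSpace _)]
      change 1 - μ.real {u | u j ≤ t} = _
      rw [hkk]
      push_cast [hkn.le]
      field_simp
      ring
    have hst : s ≤ t := by
      by_contra! hlt
      have : μ.real (halfSpace (some (j, false, s))) ≤ μ.real (halfSpace (some (j, false, t))) :=
        measureReal_mono fun u hu => lt_trans hlt hu
      linarith
    have hsub : halfSpace (some (j, false, t)) ⊆ halfSpace (some (j, false, s)) :=
      fun u hu => lt_of_le_of_lt hst hu
    refine ⟨some (j, false, ⟨n - k, by omega⟩), hsub, ?_⟩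
    change μ.real (_ \ halfSpace (some (j, false, t))) ≤ _
    rw [measureReal_sdiff hsub (measurableSet_halfSpace _), ht]
    rw [add_div] at hk2
    linarith
  · have ht := hg j ⟨k, hkn⟩ hk0
    set t := g j ⟨k, hkn⟩
    change μ.real (halfSpace (some (j, true, t))) = _ at ht
    simp only at ht
    have hst : t ≤ s := by
      by_contra! hlt
      have : μ.real (halfSpace (some (j, true, s))) ≤ μ.real (halfSpace (some (j, true, t))) :=
        measureReal_mono fun u hu => le_trans hu hlt.le
      linarith
    have hsub : halfSpace (some (j, true, t)) ⊆ halfSpace (some (j, true, s)) :=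
      fun u hu => le_trans hu hst
    refine ⟨some (j, true, ⟨k, hkn⟩), hsub, ?_⟩
    change μ.real (_ \ halfSpace (some (j, true, t))) ≤ _
    rw [measureReal_sdiff hsub (measurableSet_halfSpace _), ht]
    rw [add_div] at hk2
    linarith

/-- The box with grid thresholds. -/
def gridBox {K : ℕ} (g : Fin p → Fin n → ℝ) (c : Fin K → Option (Fin p × Bool × Fin n)) :
    Set (Fin p → ℝ) :=
  halfBox fun k => gridHalf g (c k)

lemma exists_inner_gridBox {K : ℕ} (hn : 0 < n) (μ : Measure (Fin p → ℝ)) [IsProbabilityMeasure μ]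
    (g : Fin p → Fin n → ℝ)
    (hg : ∀ (j : Fin p) (k : Fin n), 0 < (k : ℕ) → μ.real {u | u j ≤ g j k} = (k : ℝ) / n)
    (f : Fin K → Option (Fin p × Bool × ℝ)) :
    μ.real (halfBox f) ≤ 1 / n ∨ ∃ c : Fin K → Option (Fin p × Bool × Fin n),
      gridBox g c ⊆ halfBox f ∧ μ.real (halfBox f) ≤ μ.real (gridBox g c) + K / n := by
  by_cases hsmall : ∃ k, μ.real (halfSpace (f k)) ≤ 1 / n
  · obtain ⟨k, hk⟩ := hsmall
    exact Or.inl ((measureReal_mono fun u (hu : u ∈ halfBox f) => hu k).trans hk)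
  push Not at hsmall
  right
  choose c hc hc' using fun k =>
    (exists_inner_gridHalf hn μ g hg (f k)).resolve_left (not_le.2 (hsmall k))
  refine ⟨c, fun u hu k => hc k (hu k), ?_⟩
  have hsub : halfBox f ⊆ gridBox g c ∪ ⋃ k, (halfSpace (f k) \ halfSpace (gridHalf g (c k))) := by
    intro u hu
    by_cases h : u ∈ gridBox g c
    · exact Or.inl h
    · obtain ⟨k, hk⟩ := not_forall.1 h
      exact Or.inr (Set.mem_iUnion.2 ⟨k, hu k, hk⟩)
  calc μ.real (halfBox f) ≤ _ := measureReal_mono hsub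
    _ ≤ μ.real (gridBox g c) + _ := measureReal_union_le _ _
    _ ≤ μ.real (gridBox g c) + ∑ k, μ.real (halfSpace (f k) \ halfSpace (gridHalf g (c k))) := by
      gcongr; exact measureReal_iUnion_fintype_le _
    _ ≤ μ.real (gridBox g c) + ∑ _k : Fin K, 1 / (n : ℝ) := by
      gcongr with k; exact hc' k
    _ = _ := by simp [div_eq_mul_inv]

lemma exists_quantileGrid (μ : Measure (Fin p → ℝ)) [IsProbabilityMeasure μ]
    (hμ : ∀ (j : Fin p) (t : ℝ), μ {x | x j = t} = 0) (n : ℕ) :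
    ∃ g : Fin p → Fin n → ℝ,
      ∀ (j : Fin p) (k : Fin n), 0 < (k : ℕ) → μ.real {u | u j ≤ g j k} = (k : ℝ) / n := by
  have : ∀ (j : Fin p) (k : Fin n), ∃ g : ℝ,
      0 < (k : ℕ) → μ.real {u | u j ≤ g} = (k : ℝ) / n := by
    intro j k
    by_cases hk : 0 < (k : ℕ)
    · have hk' : (0 : ℝ) < (k : ℕ) := by exact_mod_cast hk
      have hkn : ((k : ℕ) : ℝ) < n := by exact_mod_cast k.2
      have hm : Measurable fun u : Fin p → ℝ => u j := measurable_pi_apply j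
      have := Measure.isProbabilityMeasure_map (μ := μ) hm.aemeasurable
      obtain ⟨g, hg⟩ := exists_cdf_eq (μ.map fun u => u j)
        (fun t => by rw [Measure.map_apply hm (measurableSet_singleton t)]; exact hμ j t)
        (a := (k : ℝ) / n) (div_pos hk' (hk'.trans hkn))
        ((div_lt_one (hk'.trans hkn)).2 hkn)
      rw [map_measureReal_apply hm measurableSet_Iic] at hg
      exact ⟨g, fun _ => hg⟩
    · exact ⟨0, fun h => absurd h hk⟩
  choose g hg using this
  exact ⟨g, hg⟩

end Grid

/-! ### Elementary inequalities for the exponential. -/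

section Elementary

/-- If $y>2b$ then $y-b\ge y/2$ and the exponential dominates the square. Taking $b$ to be the
logarithm of the size of a family turns exponential moments into a bound on the expected maximal
square, with no integration of tails. -/
lemma sq_le_add_exp_sub {y b : ℝ} (hy : 0 ≤ y) (hb : 0 ≤ b) :
    y ^ 2 ≤ 4 * b ^ 2 + 8 * Real.exp (y - b) := by
  rcases le_total y (2 * b) with h | h
  · have := Real.exp_pos (y - b)
    nlinarith
  · have h1 := Real.quadratic_le_exp_of_nonneg (show 0 ≤ y - b by linarith)
    nlinarith [sq_nonneg b]

lemma sq_le_exp_half {v : ℝ} (hv : 0 ≤ v) : v ^ 2 ≤ 8 * Real.exp (v / 2) := by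
  have h1 := Real.quadratic_le_exp_of_nonneg (show 0 ≤ v / 2 by linarith)
  nlinarith

lemma exp_le_one_add_sq_mul_exp_abs (x : ℝ) : Real.exp x ≤ 1 + x + x ^ 2 * Real.exp |x| := by
  have h := Complex.norm_exp_sub_sum_le_norm_mul_exp (x : ℂ) 2
  have h2 : Complex.exp (x : ℂ) - ∑ m ∈ Finset.range 2, (x : ℂ) ^ m / (m.factorial : ℂ) =
      ((Real.exp x - (1 + x) : ℝ) : ℂ) := by
    simp [Finset.sum_range_succ]
  rw [h2, Complex.norm_real, Complex.norm_real, Real.norm_eq_abs, Real.norm_eq_abs, sq_abs] at h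
  linarith [le_abs_self (Real.exp x - (1 + x))]

end Elementary

/-! ### Moment generating functions of noise sums. -/

section Noise

lemma integrable_exp_mul_of_orlicz {ν : Measure ℝ} {s l : ℝ} (hs : 0 < s)
    (hint : Integrable (fun e : ℝ => Real.exp (|e| / s)) ν) (hl : |l| ≤ 1 / (2 * s)) :
    Integrable (fun e : ℝ => Real.exp (l * e)) ν := by
  refine hint.mono' (by fun_prop) (ae_of_all _ fun e => ?_)
  rw [Real.norm_eq_abs, Real.abs_exp]
  gcongr
  calc l * e ≤ |l| * |e| := by rw [← abs_mul]; exact le_abs_self _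
    _ ≤ 1 / (2 * s) * |e| := by gcongr
    _ ≤ 1 / s * |e| := by
      gcongr
      linarith
    _ = |e| / s := by ring

/-- Second-order Taylor expansion: the linear term vanishes by centring. For $|l|\le 1/(2s)$ the
factors $(e/s)^2$ and $e^{|le|}$ are each controlled by $e^{|e|/(2s)}$, so their product is
integrable, and $8\cdot 2=16$. -/
lemma integral_exp_mul_le_of_orlicz {ν : Measure ℝ} [IsProbabilityMeasure ν] {s l : ℝ}
    (hs : 0 < s) (hmean : ∫ e, e ∂ν = 0)
    (hint : Integrable (fun e : ℝ => Real.exp (|e| / s)) ν)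
    (hle : ∫ e, Real.exp (|e| / s) ∂ν ≤ 2) (hl : |l| ≤ 1 / (2 * s)) :
    ∫ e, Real.exp (l * e) ∂ν ≤ Real.exp (16 * (l * s) ^ 2) := by
  have hid : Integrable (fun e : ℝ => e) ν := by
    refine (hint.const_mul s).mono' (by fun_prop) (ae_of_all _ fun e => ?_)
    have := Real.add_one_le_exp (|e| / s)
    calc ‖e‖ = s * (|e| / s) := by rw [Real.norm_eq_abs]; field_simp
      _ ≤ s * Real.exp (|e| / s) := by gcongr; linarith
  have hpt : ∀ e : ℝ, Real.exp (l * e) ≤ 1 + l * e + 8 * (l * s) ^ 2 * Real.exp (|e| / s) := by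
    intro e
    have h1 := exp_le_one_add_sq_mul_exp_abs (l * e)
    have h2 : (|e| / s) ^ 2 ≤ 8 * Real.exp (|e| / s / 2) := sq_le_exp_half (by positivity)
    have h3 : |l * e| ≤ |e| / s / 2 := by
      rw [abs_mul]
      calc |l| * |e| ≤ 1 / (2 * s) * |e| := by gcongr
        _ = _ := by field_simp
    have h4 : (l * e) ^ 2 = (l * s) ^ 2 * (|e| / s) ^ 2 := by
      rw [div_pow, sq_abs]; field_simp
    have h5 : (l * e) ^ 2 * Real.exp |l * e| ≤
        (l * s) ^ 2 * (8 * Real.exp (|e| / s / 2)) * Real.exp (|e| / s / 2) := by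
      rw [h4]; gcongr
    have h6 : Real.exp (|e| / s / 2) * Real.exp (|e| / s / 2) = Real.exp (|e| / s) := by
      rw [← Real.exp_add]; congr 1; ring
    nlinarith
  calc ∫ e, Real.exp (l * e) ∂ν
      ≤ ∫ e, (1 + l * e + 8 * (l * s) ^ 2 * Real.exp (|e| / s)) ∂ν :=
        integral_mono (integrable_exp_mul_of_orlicz hs hint hl)
          (((integrable_const 1).add (hid.const_mul l)).add (hint.const_mul _)) hpt
    _ = 1 + 8 * (l * s) ^ 2 * ∫ e, Real.exp (|e| / s) ∂ν := by
        rw [integral_add (f := fun e => 1 + l * e) ((integrable_const 1).add (hid.const_mul l))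
            (hint.const_mul _),
          integral_add (integrable_const 1) (hid.const_mul l), integral_const_mul,
          integral_const_mul, hmean]
        simp
    _ ≤ 16 * (l * s) ^ 2 + 1 := by nlinarith [sq_nonneg (l * s)]
    _ ≤ _ := Real.add_one_le_exp _

variable {n : ℕ}

lemma exp_mul_sum_eq_prod (S : Finset (Fin n)) (l : ℝ) (e : Fin n → ℝ) :
    Real.exp (l * ∑ i ∈ S, e i) = ∏ i, if i ∈ S then Real.exp (l * e i) else 1 := by
  rw [Finset.mul_sum, Real.exp_sum, Finset.prod_ite_mem, Finset.univ_inter]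

lemma exp_mul_sum_bound {ν : Measure ℝ} [IsProbabilityMeasure ν] {s l : ℝ}
    (hs : 0 < s) (hmean : ∫ e, e ∂ν = 0)
    (hint : Integrable (fun e : ℝ => Real.exp (|e| / s)) ν)
    (hle : ∫ e, Real.exp (|e| / s) ∂ν ≤ 2) (hl : |l| ≤ 1 / (2 * s)) (S : Finset (Fin n)) :
    Integrable (fun e : Fin n → ℝ => Real.exp (l * ∑ i ∈ S, e i)) (Measure.pi fun _ => ν) ∧
    ∫ e : Fin n → ℝ, Real.exp (l * ∑ i ∈ S, e i) ∂(Measure.pi fun _ => ν) ≤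
      Real.exp (16 * (l * s) ^ 2 * S.card) := by
  simp_rw [exp_mul_sum_eq_prod]
  constructor
  · refine Integrable.fintype_prod (f := fun i t => if i ∈ S then Real.exp (l * t) else 1)
      fun i => ?_
    by_cases hi : i ∈ S
    · simpa [hi] using integrable_exp_mul_of_orlicz hs hint hl
    · simp [hi]
  · rw [integral_fintype_prod_eq_prod (fun i t => if i ∈ S then Real.exp (l * t) else 1)]
    calc _ ≤ ∏ i : Fin n, if i ∈ S then Real.exp (16 * (l * s) ^ 2) else 1 := by
          refine Finset.prod_le_prod (fun i _ => ?_) fun i _ => ?_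
          · exact integral_nonneg fun t => by dsimp only; split_ifs <;> positivity
          · by_cases hi : i ∈ S
            · simpa [hi] using integral_exp_mul_le_of_orlicz hs hmean hint hle hl
            · simp [hi]
      _ = _ := by
          rw [Finset.prod_ite_mem, Finset.univ_inter, Finset.prod_const, ← Real.exp_nat_mul]
          congr 1; ring

lemma exp_mul_abs_sum_bound {ν : Measure ℝ} [IsProbabilityMeasure ν] {s l : ℝ}
    (hs : 0 < s) (hmean : ∫ e, e ∂ν = 0)
    (hint : Integrable (fun e : ℝ => Real.exp (|e| / s)) ν)
    (hle : ∫ e, Real.exp (|e| / s) ∂ν ≤ 2) (hl0 : 0 ≤ l) (hl : l ≤ 1 / (2 * s))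
    (S : Finset (Fin n)) :
    Integrable (fun e : Fin n → ℝ => Real.exp (l * |∑ i ∈ S, e i|)) (Measure.pi fun _ => ν) ∧
    ∫ e : Fin n → ℝ, Real.exp (l * |∑ i ∈ S, e i|) ∂(Measure.pi fun _ => ν) ≤
      2 * Real.exp (16 * (l * s) ^ 2 * S.card) := by
  obtain ⟨i1, b1⟩ := exp_mul_sum_bound hs hmean hint hle (l := l) (by rwa [abs_of_nonneg hl0]) S
  obtain ⟨i2, b2⟩ := exp_mul_sum_bound hs hmean hint hle (l := -l)
    (by rwa [abs_neg, abs_of_nonneg hl0]) S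
  have hpt : ∀ e : Fin n → ℝ, Real.exp (l * |∑ i ∈ S, e i|) ≤
      Real.exp (l * ∑ i ∈ S, e i) + Real.exp (-l * ∑ i ∈ S, e i) := by
    intro e
    rcases abs_cases (∑ i ∈ S, e i) with ⟨h, _⟩ | ⟨h, _⟩ <;> rw [h]
    · linarith [Real.exp_pos (-l * ∑ i ∈ S, e i)]
    · rw [mul_neg, ← neg_mul]
      linarith [Real.exp_pos (l * ∑ i ∈ S, e i)]
  have hi : Integrable (fun e : Fin n → ℝ => Real.exp (l * |∑ i ∈ S, e i|))
      (Measure.pi fun _ => ν) := by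
    refine (i1.add i2).mono' (by fun_prop) (ae_of_all _ fun e => ?_)
    rw [Real.norm_eq_abs, Real.abs_exp]
    exact hpt e
  refine ⟨hi, (integral_mono hi (i1.add i2) hpt).trans ?_⟩
  simp only [Pi.add_apply]
  rw [integral_add i1 i2]
  have : (-l * s) ^ 2 = (l * s) ^ 2 := by ring
  rw [this] at b2
  linarith

end Noise

/-! ### Lower deviations of the empirical mass of a fixed set. -/

section Population

variable {n : ℕ} {E : Type*} [MeasurableSpace E]

-- By independence the expectation is the $n$-th power of $e^{q/2}(1-(1-e^{-1})q)$ with $q=\mu(B)$.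
-- Since $e^{-1}\le 1/2$, this is at most $e^{q/2}(1-q/2)\le 1$.
open Classical in
lemma exp_half_sub_count_bound (μ : Measure E) [IsProbabilityMeasure μ] {B : Set E}
    (hB : MeasurableSet B) :
    Integrable (fun x : Fin n → E => Real.exp ((n * μ.real B -
      2 * ((Finset.univ.filter fun i => x i ∈ B).card : ℝ)) / 2)) (Measure.pi fun _ => μ) ∧
    ∫ x : Fin n → E, Real.exp ((n * μ.real B -
      2 * ((Finset.univ.filter fun i => x i ∈ B).card : ℝ)) / 2) ∂(Measure.pi fun _ => μ) ≤ 1 := by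
  have heq : ∀ x : Fin n → E, Real.exp ((n * μ.real B -
      2 * ((Finset.univ.filter fun i => x i ∈ B).card : ℝ)) / 2) =
      ∏ i, Real.exp (μ.real B / 2 - B.indicator 1 (x i)) := by
    intro x
    rw [← Real.exp_sum, Finset.sum_sub_distrib]
    congr 1
    simp only [Finset.sum_const, Finset.card_univ, Fintype.card_fin, Set.indicator_apply,
      Pi.one_apply, nsmul_eq_mul, Finset.sum_boole]
    ring
  simp_rw [heq]
  have hmeas : Measurable fun t : E => Real.exp (μ.real B / 2 - B.indicator 1 t) :=
    Real.measurable_exp.comp (measurable_const.sub (measurable_one.indicator hB))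
  have hi : Integrable (fun t : E => Real.exp (μ.real B / 2 - B.indicator 1 t)) μ := by
    refine Integrable.of_bound hmeas.aestronglyMeasurable (Real.exp (μ.real B / 2))
      (ae_of_all _ fun t => ?_)
    rw [Real.norm_eq_abs, Real.abs_exp]
    gcongr
    have : (0 : ℝ) ≤ B.indicator 1 t := Set.indicator_nonneg (fun _ _ => zero_le_one) t
    linarith
  refine ⟨Integrable.fintype_prod fun _ => hi, ?_⟩
  rw [integral_fintype_prod_eq_pow (fun t : E => Real.exp (μ.real B / 2 - B.indicator 1 t))]
  refine pow_le_one₀ (integral_nonneg fun t => (Real.exp_pos _).le) ?_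
  have hval : ∀ t : E, Real.exp (μ.real B / 2 - B.indicator 1 t) =
      Real.exp (μ.real B / 2) - Real.exp (μ.real B / 2) * (1 - Real.exp (-1)) * B.indicator 1 t := by
    intro t
    by_cases ht : t ∈ B
    · simp [ht, sub_eq_add_neg, Real.exp_add]; ring
    · simp [ht]
  simp_rw [hval]
  have hind : Integrable (B.indicator (1 : E → ℝ)) μ := (integrable_const (1 : ℝ)).indicator hB
  rw [integral_sub (integrable_const _) (hind.const_mul _), integral_const_mul,
    integral_indicator_one hB]
  simp only [integral_const, probReal_univ, one_smul]
  set q := μ.real B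
  have hq : 0 ≤ q := measureReal_nonneg
  have he : Real.exp (-1) ≤ 1 / 2 := by
    rw [Real.exp_neg, one_div]
    exact inv_anti₀ (by norm_num) (by linarith [Real.add_one_le_exp (1 : ℝ)])
  have h1 : 1 - q / 2 ≤ Real.exp (-(q / 2)) := by linarith [Real.add_one_le_exp (-(q / 2))]
  have h2 : Real.exp (q / 2) * Real.exp (-(q / 2)) = 1 := by rw [← Real.exp_add]; simp
  nlinarith [Real.exp_pos (q / 2), mul_nonneg (Real.exp_pos (q / 2)).le hq]

end Population

/-! ### From the $\psi_1$-norm to an exponential moment. -/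

section Orlicz

/-- As $s\to\infty$ the integral tends to $1<2$ by dominated convergence. Nonemptiness ensures that
the infimum in `psiOneNorm` is not the default value of `sInf`. -/
lemma exists_orlicz_le_two {ν : Measure ℝ} (h : IsNoiseLaw ν) :
    {s : ℝ | 0 < s ∧ ∫⁻ e, ENNReal.ofReal (Real.exp (|e| / s)) ∂ν ≤ 2}.Nonempty := by
  have := h.isProbabilityMeasure
  obtain ⟨α, hα, hexp⟩ := h.exp_moment
  have hl : |1 / (2 * α)| < 1 / α := by
    rw [abs_of_pos (by positivity)]
    exact one_div_lt_one_div_of_lt hα (by linarith)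
  have i1 := hexp _ hl
  have i2 := hexp (-(1 / (2 * α))) (by rwa [abs_neg])
  have hdom : Integrable (fun e : ℝ => Real.exp (|e| / (2 * α))) ν := by
    refine (i1.add i2).mono' (by fun_prop) (ae_of_all _ fun e => ?_)
    rw [Real.norm_eq_abs, Real.abs_exp, Pi.add_apply]
    rcases abs_cases e with ⟨h, _⟩ | ⟨h, _⟩ <;> rw [h]
    · rw [one_div_mul_eq_div]
      linarith [Real.exp_pos (-(1 / (2 * α)) * e)]
    · rw [neg_mul, one_div_mul_eq_div, neg_div]
      linarith [Real.exp_pos (e / (2 * α))]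
  have hbound : ∀ s : ℝ, 2 * α ≤ s → ∀ e : ℝ, ‖Real.exp (|e| / s)‖ ≤ Real.exp (|e| / (2 * α)) := by
    intro s hs e
    rw [Real.norm_eq_abs, Real.abs_exp]
    gcongr
  have hlim : Tendsto (fun s : ℝ => ∫ e, Real.exp (|e| / s) ∂ν) atTop
      (nhds (∫ _e, (1 : ℝ) ∂ν)) := by
    refine tendsto_integral_filter_of_dominated_convergence
      (fun e => Real.exp (|e| / (2 * α))) (Eventually.of_forall fun s => by fun_prop)
      ?_ hdom (ae_of_all _ fun e => ?_)
    · filter_upwards [eventually_ge_atTop (2 * α)] with s hs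
      exact ae_of_all _ (hbound s hs)
    · have h0 : Tendsto (fun s : ℝ => |e| / s) atTop (nhds 0) :=
        tendsto_const_nhds.div_atTop tendsto_id
      simpa [Function.comp_def] using (Real.continuous_exp.tendsto 0).comp h0
  simp only [integral_const, probReal_univ, smul_eq_mul, mul_one] at hlim
  obtain ⟨s, hs1, hs2⟩ := ((hlim.eventually_le_const (show (1 : ℝ) < 2 by norm_num)).and
    (eventually_ge_atTop (2 * α))).exists
  refine ⟨s, by linarith, ?_⟩
  have hi : Integrable (fun e : ℝ => Real.exp (|e| / s)) ν :=
    hdom.mono' (by fun_prop) (ae_of_all _ (hbound s hs2))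
  rw [← ofReal_integral_eq_lintegral_ofReal hi (ae_of_all _ fun e => (Real.exp_pos _).le)]
  exact (ENNReal.ofReal_le_ofReal hs1).trans (by simp)

lemma orlicz_of_psiOneNorm_lt {ν : Measure ℝ} (h : IsNoiseLaw ν) {s : ℝ}
    (hs : psiOneNorm ν < s) :
    Integrable (fun e : ℝ => Real.exp (|e| / s)) ν ∧ ∫ e, Real.exp (|e| / s) ∂ν ≤ 2 := by
  obtain ⟨r, ⟨hr0, hr⟩, hrs⟩ := exists_lt_of_csInf_lt (exists_orlicz_le_two h) hs
  have hle : ∫⁻ e, ENNReal.ofReal (Real.exp (|e| / s)) ∂ν ≤ 2 := by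
    refine le_trans (lintegral_mono fun e => ?_) hr
    gcongr
  have hi : Integrable (fun e : ℝ => Real.exp (|e| / s)) ν :=
    ⟨by fun_prop, by
      rw [hasFiniteIntegral_iff_ofReal (ae_of_all _ fun e => (Real.exp_pos _).le)]
      exact hle.trans_lt (by simp)⟩
  refine ⟨hi, ?_⟩
  rw [← ofReal_integral_eq_lintegral_ofReal hi (ae_of_all _ fun e => (Real.exp_pos _).le)] at hle
  rwa [ENNReal.ofReal_le_iff_le_toReal (by simp)] at hle

end Orlicz

/-! ### Uniform bounds over boxes: largest noise, mass excess, noise sums. -/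

section Bounds

lemma integral_const_add_const_mul {E : Type*} [MeasurableSpace E] {μ : Measure E}
    [IsProbabilityMeasure μ] {f : E → ℝ} (hf : Integrable f μ) (a b : ℝ) :
    Integrable (fun x => a + b * f x) μ ∧ ∫ x, (a + b * f x) ∂μ = a + b * ∫ x, f x ∂μ := by
  refine ⟨(integrable_const a).add (hf.const_mul b), ?_⟩
  rw [integral_add (integrable_const a) (hf.const_mul b), integral_const_mul]
  simp

variable {n p : ℕ}

/-- The logarithmic size of the family of boxes with `K` sides, each chosen from `1 + 2 p n`
half-spaces. -/
def boxEntropy (n p K : ℕ) : ℝ := (K + 1) * Real.log (1 + 2 * p * n)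

lemma one_le_log_codes (hn : 1 ≤ n) (hp : 1 ≤ p) : 1 ≤ Real.log (1 + 2 * p * n) := by
  have hn' : (1 : ℝ) ≤ n := by exact_mod_cast hn
  have hp' : (1 : ℝ) ≤ p := by exact_mod_cast hp
  rw [Real.le_log_iff_exp_le (by positivity)]
  nlinarith [Real.exp_one_lt_d9]

lemma nat_add_one_le_boxEntropy (hn : 1 ≤ n) (hp : 1 ≤ p) (K : ℕ) :
    (K : ℝ) + 1 ≤ boxEntropy n p K := by
  rw [boxEntropy]
  nlinarith [one_le_log_codes hn hp, (Nat.cast_nonneg K : (0 : ℝ) ≤ K)]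

/-- The exponent $K+1$ in `boxEntropy`, instead of $K$, leaves a spare factor $1+2pn\ge 2$, which
absorbs the $2$ of two-sided bounds. -/
lemma two_mul_card_codes_le (hn : 1 ≤ n) (hp : 1 ≤ p) (K : ℕ) :
    2 * (Fintype.card (Fin K → Option (Fin p × Bool × Fin n)) : ℝ) ≤
      Real.exp (boxEntropy n p K) := by
  have hn' : (1 : ℝ) ≤ n := by exact_mod_cast hn
  have hp' : (1 : ℝ) ≤ p := by exact_mod_cast hp
  have hpos : (0 : ℝ) < 1 + 2 * p * n := by positivity
  have h : Real.exp (boxEntropy n p K) = (1 + 2 * p * n : ℝ) ^ (K + 1) := by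
    rw [boxEntropy, ← Nat.cast_add_one, Real.exp_nat_mul, Real.exp_log hpos]
  have h2 : (Fintype.card (Fin K → Option (Fin p × Bool × Fin n)) : ℝ) =
      (1 + 2 * p * n : ℝ) ^ K := by
    simp only [Fintype.card_fun, Fintype.card_option, Fintype.card_prod, Fintype.card_fin,
      Fintype.card_bool]
    push_cast
    ring
  rw [h, h2, pow_succ, mul_comm]
  gcongr
  nlinarith

/-- An upper bound for the largest squared noise variable. -/
def maxSqBound (s : ℝ) (e : Fin n → ℝ) : ℝ :=
  s ^ 2 * (4 * Real.log (2 * n) ^ 2 + 4 / n * ∑ i, Real.exp (|e i| / s))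

lemma maxSqBound_nonneg (s : ℝ) (e : Fin n → ℝ) : 0 ≤ maxSqBound s e := by
  have : 0 ≤ ∑ i, Real.exp (|e i| / s) := Finset.sum_nonneg fun i _ => (Real.exp_pos _).le
  unfold maxSqBound
  positivity

/-- This is `sq_le_add_exp_sub` with $b=\log(2n)$: the sum of the $n$ exponentials has mean at most
$2n$, so its contribution stays bounded. -/
lemma sq_le_maxSqBound {s : ℝ} (hs : 0 < s) (e : Fin n → ℝ) (i : Fin n) :
    e i ^ 2 ≤ maxSqBound s e := by
  have hn : (1 : ℝ) ≤ n := by exact_mod_cast i.pos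
  have h1 := sq_le_add_exp_sub (y := |e i| / s) (b := Real.log (2 * n)) (by positivity)
    (Real.log_nonneg (by linarith))
  rw [Real.exp_sub, Real.exp_log (by positivity), div_pow, sq_abs] at h1
  have h2 : Real.exp (|e i| / s) ≤ ∑ i, Real.exp (|e i| / s) :=
    Finset.single_le_sum (f := fun i => Real.exp (|e i| / s)) (fun i _ => (Real.exp_pos _).le)
      (Finset.mem_univ i)
  have h3 : 8 * (Real.exp (|e i| / s) / (2 * n)) = 4 / n * Real.exp (|e i| / s) := by
    field_simp; ring
  rw [h3, div_le_iff₀ (by positivity)] at h1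
  rw [maxSqBound, mul_comm]
  refine h1.trans ?_
  gcongr

lemma maxSqBound_bound {ν : Measure ℝ} [IsProbabilityMeasure ν] {s : ℝ} (hn : 1 ≤ n)
    (hint : Integrable (fun e : ℝ => Real.exp (|e| / s)) ν)
    (hle : ∫ e, Real.exp (|e| / s) ∂ν ≤ 2) :
    Integrable (maxSqBound s : (Fin n → ℝ) → ℝ) (Measure.pi fun _ => ν) ∧
    ∫ e : Fin n → ℝ, maxSqBound s e ∂(Measure.pi fun _ => ν) ≤
      s ^ 2 * (4 * Real.log (2 * n) ^ 2 + 8) := by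
  have hn' : (0 : ℝ) < n := by exact_mod_cast hn
  have hi : ∀ i : Fin n, Integrable (fun e : Fin n → ℝ => Real.exp (|e i| / s))
      (Measure.pi fun _ => ν) := fun i =>
    (measurePreserving_eval (fun _ : Fin n => ν) i).integrable_comp_of_integrable hint
  have hv : ∀ i : Fin n, ∫ e : Fin n → ℝ, Real.exp (|e i| / s) ∂(Measure.pi fun _ => ν) ≤ 2 := by
    intro i
    have := integral_comp_eval (μ := fun _ : Fin n => ν) (i := i)
      (f := fun t : ℝ => Real.exp (|t| / s)) hint.aestronglyMeasurable
    rwa [this]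
  have hsum := integrable_finsetSum Finset.univ fun i _ => hi i
  have hI : Integrable (maxSqBound s : (Fin n → ℝ) → ℝ) (Measure.pi fun _ => ν) :=
    ((integrable_const _).add (hsum.const_mul _)).const_mul _
  refine ⟨hI, ?_⟩
  unfold maxSqBound
  rw [integral_const_mul, (integral_const_add_const_mul hsum _ _).2,
    integral_finsetSum _ fun i _ => hi i]
  have : ∑ i : Fin n, ∫ e : Fin n → ℝ, Real.exp (|e i| / s) ∂(Measure.pi fun _ => ν) ≤ n * 2 := by
    refine (Finset.sum_le_sum fun i _ => hv i).trans ?_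
    simp
  gcongr
  calc _ ≤ 4 / (n : ℝ) * (n * 2) := by gcongr
    _ = 8 := by field_simp; norm_num

open Classical in
/-- An upper bound for the excess of the probability of a box over twice its empirical
probability, uniformly over the boxes with at most `K` sides. -/
def massExcess (μ : Measure (Fin p → ℝ)) (g : Fin p → Fin n → ℝ) (K : ℕ)
    (x : Fin n → Fin p → ℝ) : ℝ :=
  K / n + 2 / n * (boxEntropy n p K + Real.exp (-boxEntropy n p K) *
    ∑ c : Fin K → Option (Fin p × Bool × Fin n), Real.exp ((n * μ.real (gridBox g c) -
      2 * ((Finset.univ.filter fun i => x i ∈ gridBox g c).card : ℝ)) / 2))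

lemma boxEntropy_nonneg (n p K : ℕ) : 0 ≤ boxEntropy n p K :=
  mul_nonneg (by positivity) (Real.log_nonneg (by nlinarith [(by positivity : (0 : ℝ) ≤ p * n)]))

lemma massExcess_nonneg (μ : Measure (Fin p → ℝ)) (g : Fin p → Fin n → ℝ) (K : ℕ)
    (x : Fin n → Fin p → ℝ) : 0 ≤ massExcess μ g K x := by
  unfold massExcess
  have := boxEntropy_nonneg n p K
  positivity

lemma measureReal_halfBox_le {K : ℕ} (hn : 1 ≤ n) (hp : 1 ≤ p) (μ : Measure (Fin p → ℝ))
    [IsProbabilityMeasure μ] (g : Fin p → Fin n → ℝ)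
    (hg : ∀ (j : Fin p) (k : Fin n), 0 < (k : ℕ) → μ.real {u | u j ≤ g j k} = (k : ℝ) / n)
    (D : Dataset n p) (f : Fin K → Option (Fin p × Bool × ℝ)) :
    μ.real (halfBox f) ≤ 2 * (nodePoints D (halfBox f)).card / n +
      massExcess μ g K (fun i => (D i).2) := by
  classical
  have hn' : (0 : ℝ) < n := by exact_mod_cast hn
  have hL := nat_add_one_le_boxEntropy hn hp K
  have hK : (0 : ℝ) ≤ K := Nat.cast_nonneg K
  unfold massExcess
  rcases exists_inner_gridBox hn μ g hg f with h | ⟨c, hsub, hc⟩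
  · refine h.trans (le_add_of_nonneg_of_le (by positivity) (le_add_of_nonneg_of_le
      (by positivity) ?_))
    rw [div_mul_eq_mul_div]
    gcongr
    have : 0 ≤ Real.exp (-boxEntropy n p K) *
      ∑ c : Fin K → Option (Fin p × Bool × Fin n), Real.exp ((n * μ.real (gridBox g c) -
      2 * ((Finset.univ.filter fun i => (D i).2 ∈ gridBox g c).card : ℝ)) / 2) := by positivity
    linarith
  · set N : ℝ := ((Finset.univ.filter fun i => (D i).2 ∈ gridBox g c).card : ℝ)
    have hN : N ≤ (nodePoints D (halfBox f)).card := by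
      refine Nat.cast_le.2 (Finset.card_le_card fun i hi => ?_)
      simp only [Finset.mem_filter, Finset.mem_univ, true_and, nodePoints] at hi ⊢
      exact hsub hi
    have h1 := Finset.single_le_sum
      (f := fun c : Fin K → Option (Fin p × Bool × Fin n) => Real.exp ((n * μ.real (gridBox g c) -
      2 * ((Finset.univ.filter fun i => (D i).2 ∈ gridBox g c).card : ℝ)) / 2))
      (fun i _ => (Real.exp_pos _).le) (Finset.mem_univ c)
    -- With $t=(n\mu(B)-2N)/2$ this gives $t\le L+e^{t-L}$, and $e^t$ is one term of the sum in
    -- `massExcess`.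
    have h2 := Real.add_one_le_exp
      (-boxEntropy n p K + (n * μ.real (gridBox g c) - 2 * N) / 2)
    rw [Real.exp_add] at h2
    have h3 := mul_le_mul_of_nonneg_left h1 (Real.exp_pos (-boxEntropy n p K)).le
    set Z := Real.exp (-boxEntropy n p K) *
      ∑ c : Fin K → Option (Fin p × Bool × Fin n), Real.exp ((n * μ.real (gridBox g c) -
      2 * ((Finset.univ.filter fun i => (D i).2 ∈ gridBox g c).card : ℝ)) / 2)
    have h4 : n * μ.real (gridBox g c) ≤ 2 * N + 2 * (boxEntropy n p K + Z) := by
      linarith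
    have h5 : μ.real (gridBox g c) ≤ (2 * N + 2 * (boxEntropy n p K + Z)) / n := by
      rw [le_div_iff₀ hn']; linarith
    calc μ.real (halfBox f) ≤ (2 * N + 2 * (boxEntropy n p K + Z)) / n + K / n := by linarith
      _ ≤ (2 * (nodePoints D (halfBox f)).card + 2 * (boxEntropy n p K + Z)) / n + K / n := by
        gcongr
      _ = _ := by ring

lemma massExcess_bound {K : ℕ} (hn : 1 ≤ n) (hp : 1 ≤ p) (μ : Measure (Fin p → ℝ))
    [IsProbabilityMeasure μ] (g : Fin p → Fin n → ℝ) :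
    Integrable (massExcess μ g K) (Measure.pi fun _ => μ) ∧
    ∫ x, massExcess μ g K x ∂(Measure.pi fun _ => μ) ≤ 5 * boxEntropy n p K / n := by
  classical
  have hn' : (0 : ℝ) < n := by exact_mod_cast hn
  have hb := fun c : Fin K → Option (Fin p × Bool × Fin n) =>
    exp_half_sub_count_bound (n := n) μ (measurableSet_halfBox fun k => gridHalf g (c k))
  have hsum := integrable_finsetSum Finset.univ fun c _ => (hb c).1
  have hle := Finset.sum_le_sum fun c (_ : c ∈ Finset.univ) => (hb c).2
  rw [← integral_finsetSum _ fun c _ => (hb c).1, Finset.sum_const, Finset.card_univ,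
    nsmul_eq_mul, mul_one] at hle
  constructor
  · exact (integral_const_add_const_mul (integral_const_add_const_mul hsum _ _).1 _ _).1
  · unfold massExcess gridBox
    have hcard := two_mul_card_codes_le hn hp K
    rw [(integral_const_add_const_mul (integral_const_add_const_mul hsum _ _).1 _ _).2,
      (integral_const_add_const_mul hsum _ _).2]
    have h1 := mul_le_mul_of_nonneg_left hle (Real.exp_pos (-boxEntropy n p K)).le
    have h2 : Real.exp (-boxEntropy n p K) * Real.exp (boxEntropy n p K) = 1 := by
      rw [← Real.exp_add]; simp
    have h3 : Real.exp (-boxEntropy n p K) *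
        (Fintype.card (Fin K → Option (Fin p × Bool × Fin n)) : ℝ) ≤ 1 := by
      nlinarith [Real.exp_pos (-boxEntropy n p K)]
    have h4 := h1.trans h3
    have hL := nat_add_one_le_boxEntropy hn hp K
    have hK : (0 : ℝ) ≤ K := Nat.cast_nonneg K
    calc _ ≤ (K : ℝ) / n + 2 / n * (boxEntropy n p K + 1) := by gcongr
      _ = (K + 2 * (boxEntropy n p K + 1)) / n := by ring
      _ ≤ _ := by gcongr; linarith

/-- The scale at which the noise sum over `N` data points is exponentiated. -/
def noiseScale (s L N : ℝ) : ℝ := √(L / max N L) / (2 * s)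

/-- The exponentiated noise sum over the data points in `S`. -/
def expNoiseSum (s L : ℝ) (S : Finset (Fin n)) (e : Fin n → ℝ) : ℝ :=
  Real.exp (noiseScale s L S.card * |∑ i ∈ S, e i|)

/-- The exponential moments of the noise sums over all boxes with at most `K` sides. -/
def noiseExp (s : ℝ) (K : ℕ) (q : (Fin n → Fin p → ℝ) × (Fin n → ℝ)) : ℝ :=
  ∑ c : Fin K → Option (Fin p × Bool × Fin n),
    expNoiseSum s (boxEntropy n p K) (traceBox q.1 c) q.2

/-- An upper bound for the squared noise sums over boxes, divided by the number of data points,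
uniformly over the boxes with at most `K` sides. -/
def noiseBound (s : ℝ) (K : ℕ) (q : (Fin n → Fin p → ℝ) × (Fin n → ℝ)) : ℝ :=
  boxEntropy n p K * maxSqBound s q.2 + 4 * s ^ 2 / boxEntropy n p K *
    (4 * (5 * boxEntropy n p K) ^ 2 + 8 * (Real.exp (-(5 * boxEntropy n p K)) * noiseExp s K q))

/-- Two regimes. For $|S|\le L$, Cauchy–Schwarz bounds the ratio by $|S|$ times the largest squared
noise. For $|S|\ge L$, the Chernoff scale $\sqrt{L/|S|}/(2s)$ is small enough for the moment
generating function bound. -/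
lemma sq_sum_div_card_le {s : ℝ} (hs : 0 < s) {K : ℕ} (hn : 1 ≤ n) (hp : 1 ≤ p)
    (x : Fin n → Fin p → ℝ) (e : Fin n → ℝ) (c : Fin K → Option (Fin p × Bool × Fin n))
    (hne : (traceBox x c).Nonempty) :
    (∑ i ∈ traceBox x c, e i) ^ 2 / (traceBox x c).card ≤ noiseBound s K (x, e) := by
  set S := traceBox x c with hS
  set L := boxEntropy n p K with hLdef
  have hL : 1 ≤ L := by
    linarith [nat_add_one_le_boxEntropy hn hp K, (Nat.cast_nonneg K : (0 : ℝ) ≤ K)]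
  have hL0 : 0 < L := by linarith
  have hN : (0 : ℝ) < S.card := by exact_mod_cast hne.card_pos
  have hm := maxSqBound_nonneg s e
  have hE : 0 ≤ noiseExp s K (x, e) := Finset.sum_nonneg fun c _ => (Real.exp_pos _).le
  unfold noiseBound
  rw [← hLdef]
  simp only
  rcases le_total (S.card : ℝ) L with h | h
  · have h1 : (∑ i ∈ S, e i) ^ 2 ≤ S.card * ∑ i ∈ S, e i ^ 2 := sq_sum_le_card_mul_sum_sq
    have h2 : ∑ i ∈ S, e i ^ 2 ≤ S.card * maxSqBound s e := by
      rw [← nsmul_eq_mul]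
      exact Finset.sum_le_card_nsmul _ _ _ fun i _ => sq_le_maxSqBound hs e i
    have h3 : (∑ i ∈ S, e i) ^ 2 / S.card ≤ S.card * maxSqBound s e := by
      rw [div_le_iff₀ hN]
      nlinarith
    have h4 : S.card * maxSqBound s e ≤ L * maxSqBound s e := by gcongr
    have h5 : 0 ≤ 4 * s ^ 2 / L * (4 * (5 * L) ^ 2 + 8 * (Real.exp (-(5 * L)) *
      noiseExp s K (x, e))) := by positivity
    linarith
  · set l := noiseScale s L S.card with hl
    have hl2 : l ^ 2 = L / S.card / (4 * s ^ 2) := by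
      rw [hl, noiseScale, max_eq_left h, div_pow, Real.sq_sqrt (by positivity)]
      ring
    have hl0 : 0 ≤ l := by rw [hl, noiseScale]; positivity
    -- The level $5L$ is $4L$ from each exponential moment plus $L$ from the number of boxes, as in
    -- `noiseExp_bound`.
    have h1 := sq_le_add_exp_sub (y := l * |∑ i ∈ S, e i|) (b := 5 * L) (by positivity)
      (by positivity)
    have h2 : Real.exp (l * |∑ i ∈ S, e i|) ≤ noiseExp s K (x, e) :=
      Finset.single_le_sum (f := fun c : Fin K → Option (Fin p × Bool × Fin n) =>
        expNoiseSum s L (traceBox x c) e)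
        (fun i _ => (Real.exp_pos _).le) (Finset.mem_univ c)
    have h3 : Real.exp (l * |∑ i ∈ S, e i| - 5 * L) ≤
        Real.exp (-(5 * L)) * noiseExp s K (x, e) := by
      rw [sub_eq_add_neg, Real.exp_add, mul_comm]
      gcongr
    have h4 : (∑ i ∈ S, e i) ^ 2 / S.card = 4 * s ^ 2 / L * (l * |∑ i ∈ S, e i|) ^ 2 := by
      rw [mul_pow, sq_abs, hl2]
      field_simp
    rw [h4]
    have h5 : 4 * s ^ 2 / L * (l * |∑ i ∈ S, e i|) ^ 2 ≤ 4 * s ^ 2 / L *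
        (4 * (5 * L) ^ 2 + 8 * (Real.exp (-(5 * L)) * noiseExp s K (x, e))) := by
      gcongr
      linarith
    have h6 : 0 ≤ L * maxSqBound s e := by positivity
    linarith

lemma measurableSet_traceHalf (c : Option (Fin p × Bool × Fin n)) (i : Fin n) :
    MeasurableSet {x : Fin n → Fin p → ℝ | i ∈ traceHalf x c} := by
  rcases c with _ | ⟨j, _ | _, l⟩
  · exact MeasurableSet.univ
  · exact measurableSet_le (f := fun x : Fin n → Fin p → ℝ => x l j) (g := fun x => x i j)
      (by fun_prop) (by fun_prop)
  · exact measurableSet_le (f := fun x : Fin n → Fin p → ℝ => x i j) (g := fun x => x l j)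
      (by fun_prop) (by fun_prop)

lemma measurableSet_traceBox_eq {K : ℕ} (c : Fin K → Option (Fin p × Bool × Fin n))
    (S : Finset (Fin n)) : MeasurableSet {x : Fin n → Fin p → ℝ | traceBox x c = S} := by
  have h : {x : Fin n → Fin p → ℝ | traceBox x c = S} =
      ⋂ i, {x | (∀ k, i ∈ traceHalf x (c k)) ↔ i ∈ S} := by
    ext x
    simp [Finset.ext_iff, traceBox]
  rw [h]
  refine MeasurableSet.iInter fun i => ?_
  have hA : MeasurableSet {x : Fin n → Fin p → ℝ | ∀ k, i ∈ traceHalf x (c k)} := by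
    rw [Set.ofPred_forall]
    exact MeasurableSet.iInter fun k => measurableSet_traceHalf (c k) i
  by_cases hi : i ∈ S
  · simpa [hi] using hA
  · simp only [hi, iff_false]
    exact hA.compl

/-- The trace takes finitely many values, each on a measurable event of covariates. -/
lemma measurable_comp_traceBox {K : ℕ} (c : Fin K → Option (Fin p × Bool × Fin n))
    (G : Finset (Fin n) → (Fin n → ℝ) → ℝ) (hG : ∀ S, Measurable (G S)) :
    Measurable fun q : (Fin n → Fin p → ℝ) × (Fin n → ℝ) => G (traceBox q.1 c) q.2 := by
  classical
  have h : (fun q : (Fin n → Fin p → ℝ) × (Fin n → ℝ) => G (traceBox q.1 c) q.2) =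
      fun q => ∑ S, if traceBox q.1 c = S then G S q.2 else 0 := by
    ext q
    simp
  rw [h]
  refine Finset.measurable_sum _ fun S _ => Measurable.ite ?_ ((hG S).comp measurable_snd)
    measurable_const
  exact measurable_fst (measurableSet_traceBox_eq c S)

lemma expNoiseSum_bound {ν : Measure ℝ} [IsProbabilityMeasure ν] {s L : ℝ}
    (hs : 0 < s) (hL : 0 < L) (hmean : ∫ e, e ∂ν = 0)
    (hint : Integrable (fun e : ℝ => Real.exp (|e| / s)) ν)
    (hle : ∫ e, Real.exp (|e| / s) ∂ν ≤ 2) (S : Finset (Fin n)) :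
    Integrable (expNoiseSum s L S) (Measure.pi fun _ => ν) ∧
    ∫ e, expNoiseSum s L S e ∂(Measure.pi fun _ => ν) ≤ 2 * Real.exp (4 * L) := by
  have hmax : 0 < max (S.card : ℝ) L := lt_max_of_lt_right hL
  -- The maximum in `noiseScale` keeps the scale below $1/(2s)$ for small $S$ as well, and the
  -- exponent is at most $4L$ whatever the size of $S$.
  have hsq : √(L / max (S.card : ℝ) L) ≤ 1 :=
    Real.sqrt_le_one.2 ((div_le_one hmax).2 (le_max_right _ _))
  obtain ⟨h1, h2⟩ := exp_mul_abs_sum_bound hs hmean hint hle (l := noiseScale s L S.card)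
    (by unfold noiseScale; positivity) (by unfold noiseScale; gcongr) S
  refine ⟨h1, h2.trans ?_⟩
  have h3 : 16 * (noiseScale s L S.card * s) ^ 2 * S.card ≤ 4 * L := by
    rw [noiseScale, mul_pow, div_pow, Real.sq_sqrt (by positivity)]
    calc _ = 4 * L * (S.card / max (S.card : ℝ) L) := by field_simp; ring
      _ ≤ 4 * L * 1 := by
        gcongr
        rw [div_le_one hmax]
        exact le_max_left _ _
      _ = _ := by ring
  gcongr

/-- For a fixed code and fixed covariates the trace is a deterministic index set, so Fubini carries
over a bound that is uniform in $S$. -/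
lemma integral_comp_traceBox_bound {ν : Measure ℝ} [IsProbabilityMeasure ν]
    (μ : Measure (Fin p → ℝ)) [IsProbabilityMeasure μ] {K : ℕ}
    (c : Fin K → Option (Fin p × Bool × Fin n)) {B : ℝ}
    (G : Finset (Fin n) → (Fin n → ℝ) → ℝ) (hG : ∀ S, Measurable (G S)) (hG0 : ∀ S e, 0 ≤ G S e)
    (hB : ∀ S, Integrable (G S) (Measure.pi fun _ => ν) ∧
      ∫ e, G S e ∂(Measure.pi fun _ => ν) ≤ B) :
    Integrable (fun q : (Fin n → Fin p → ℝ) × (Fin n → ℝ) => G (traceBox q.1 c) q.2)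
      ((Measure.pi fun _ : Fin n => μ).prod (Measure.pi fun _ : Fin n => ν)) ∧
    ∫ q : (Fin n → Fin p → ℝ) × (Fin n → ℝ), G (traceBox q.1 c) q.2
      ∂((Measure.pi fun _ : Fin n => μ).prod (Measure.pi fun _ : Fin n => ν)) ≤ B := by
  have hmeas := measurable_comp_traceBox c G hG
  have hI : Integrable (fun q : (Fin n → Fin p → ℝ) × (Fin n → ℝ) => G (traceBox q.1 c) q.2)
      ((Measure.pi fun _ : Fin n => μ).prod (Measure.pi fun _ : Fin n => ν)) := by
    rw [integrable_prod_iff hmeas.aestronglyMeasurable]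
    refine ⟨ae_of_all _ fun x => (hB (traceBox x c)).1, ?_⟩
    refine Integrable.of_bound
      hmeas.aestronglyMeasurable.norm.integral_prod_right' B (ae_of_all _ fun x => ?_)
    rw [Real.norm_eq_abs, abs_of_nonneg (integral_nonneg fun _ => norm_nonneg _)]
    simp only [Real.norm_eq_abs, abs_of_nonneg (hG0 _ _)]
    exact (hB _).2
  refine ⟨hI, ?_⟩
  rw [integral_prod _ hI]
  calc _ ≤ ∫ _x : Fin n → Fin p → ℝ, B ∂(Measure.pi fun _ => μ) :=
        integral_mono hI.integral_prod_left (integrable_const _) fun x => (hB (traceBox x c)).2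
    _ = _ := by simp

lemma noiseExp_bound {ν : Measure ℝ} [IsProbabilityMeasure ν] (μ : Measure (Fin p → ℝ))
    [IsProbabilityMeasure μ] {s : ℝ} {K : ℕ} (hn : 1 ≤ n) (hp : 1 ≤ p)
    (hs : 0 < s) (hmean : ∫ e, e ∂ν = 0)
    (hint : Integrable (fun e : ℝ => Real.exp (|e| / s)) ν)
    (hle : ∫ e, Real.exp (|e| / s) ∂ν ≤ 2) :
    Integrable (noiseExp s K)
      ((Measure.pi fun _ : Fin n => μ).prod (Measure.pi fun _ : Fin n => ν)) ∧
    ∫ q, noiseExp s K q ∂((Measure.pi fun _ : Fin n => μ).prod (Measure.pi fun _ : Fin n => ν)) ≤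
      Real.exp (5 * boxEntropy n p K) := by
  have hL0 : 0 < boxEntropy n p K := by
    linarith [nat_add_one_le_boxEntropy hn hp K, (Nat.cast_nonneg K : (0 : ℝ) ≤ K)]
  have main := fun c : Fin K → Option (Fin p × Bool × Fin n) =>
    integral_comp_traceBox_bound (ν := ν) μ c (expNoiseSum s (boxEntropy n p K))
      (fun S => by unfold expNoiseSum; fun_prop) (fun S e => (Real.exp_pos _).le)
      (expNoiseSum_bound hs hL0 hmean hint hle)
  have hsum := Finset.sum_le_sum fun c (_ : c ∈ Finset.univ) => (main c).2
  rw [← integral_finsetSum _ fun c _ => (main c).1, Finset.sum_const, Finset.card_univ,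
    nsmul_eq_mul] at hsum
  refine ⟨integrable_finsetSum _ fun c _ => (main c).1, hsum.trans ?_⟩
  have hcard := two_mul_card_codes_le hn hp K
  have h5 : Real.exp (5 * boxEntropy n p K) =
      Real.exp (boxEntropy n p K) * Real.exp (4 * boxEntropy n p K) := by
    rw [← Real.exp_add]
    congr 1
    ring
  rw [h5, ← mul_assoc, mul_comm _ (2 : ℝ)]
  gcongr

lemma noiseBound_bound {ν : Measure ℝ} [IsProbabilityMeasure ν] (μ : Measure (Fin p → ℝ))
    [IsProbabilityMeasure μ] {s : ℝ} {K : ℕ} (hn : 1 ≤ n) (hp : 1 ≤ p)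
    (hs : 0 < s) (hmean : ∫ e, e ∂ν = 0)
    (hint : Integrable (fun e : ℝ => Real.exp (|e| / s)) ν)
    (hle : ∫ e, Real.exp (|e| / s) ∂ν ≤ 2) :
    Integrable (noiseBound s K)
      ((Measure.pi fun _ : Fin n => μ).prod (Measure.pi fun _ : Fin n => ν)) ∧
    ∫ q, noiseBound s K q
      ∂((Measure.pi fun _ : Fin n => μ).prod (Measure.pi fun _ : Fin n => ν)) ≤
      s ^ 2 * boxEntropy n p K * (4 * Real.log (2 * n) ^ 2 + 440) := by
  obtain ⟨i1, b1⟩ := maxSqBound_bound hn hint hle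
  obtain ⟨i2, b2⟩ := noiseExp_bound (n := n) (K := K) μ hn hp hs hmean hint hle
  set L := boxEntropy n p K with hLdef
  have hL : 1 ≤ L := by
    linarith [nat_add_one_le_boxEntropy hn hp K, (Nat.cast_nonneg K : (0 : ℝ) ≤ K)]
  have hL0 : 0 < L := by linarith
  have i1' := i1.comp_snd (μ := Measure.pi fun _ : Fin n => μ)
  obtain ⟨i3, b3⟩ := integral_const_add_const_mul (i2.const_mul (Real.exp (-(5 * L))))
    (4 * (5 * L) ^ 2) 8
  rw [integral_const_mul] at b3
  refine ⟨(i1'.const_mul _).add (i3.const_mul _), ?_⟩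
  unfold noiseBound
  rw [← hLdef, integral_add (i1'.const_mul _) (i3.const_mul _), integral_const_mul,
    integral_const_mul, b3, integral_fun_snd (maxSqBound s)]
  simp only [probReal_univ, one_smul]
  have h2 : Real.exp (-(5 * L)) * Real.exp (5 * L) = 1 := by
    rw [← Real.exp_add]; simp
  have h3 := mul_le_mul_of_nonneg_left b2 (Real.exp_pos (-(5 * L))).le
  rw [h2] at h3
  calc _ ≤ L * (s ^ 2 * (4 * Real.log (2 * n) ^ 2 + 8)) +
        4 * s ^ 2 / L * (4 * (5 * L) ^ 2 + 8 * 1) := by gcongr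
    _ = s ^ 2 * L * (4 * Real.log (2 * n) ^ 2 + 408) + 32 * s ^ 2 * (1 / L) := by
      field_simp; ring
    _ ≤ s ^ 2 * L * (4 * Real.log (2 * n) ^ 2 + 408) + 32 * s ^ 2 * L := by
      gcongr
      rw [div_le_iff₀ hL0]
      nlinarith
    _ = _ := by ring

end Bounds

/-! ### From the error on one cell to the error of the tree. -/

section CellBounds

variable {n p : ℕ}

lemma cartEstimate_sub_eq {T : CartTree p} {D : Dataset n p} {c : ℝ} {e : Fin n → ℝ}
    (he : ∀ i, (D i).1 = c + e i) {x : Fin p → ℝ} (hne : (nodePoints D (T.cell x)).Nonempty) :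
    cartEstimate T D x - c =
      (∑ i ∈ nodePoints D (T.cell x), e i) / (nodePoints D (T.cell x)).card := by
  have hN : ((nodePoints D (T.cell x)).card : ℝ) ≠ 0 := by exact_mod_cast hne.card_pos.ne'
  rw [cartEstimate, if_neg hne.card_pos.ne']
  simp only [he, Finset.sum_add_distrib, Finset.sum_const, nsmul_eq_mul]
  field_simp
  ring

lemma sq_mean_le_maxSqBound {s : ℝ} (hs : 0 < s) (e : Fin n → ℝ) {S : Finset (Fin n)}
    (hS : S.Nonempty) : ((∑ i ∈ S, e i) / S.card) ^ 2 ≤ maxSqBound s e := by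
  have hN : (0 : ℝ) < S.card := by exact_mod_cast hS.card_pos
  have h1 : (∑ i ∈ S, e i) ^ 2 ≤ S.card * ∑ i ∈ S, e i ^ 2 := sq_sum_le_card_mul_sum_sq
  have h2 : ∑ i ∈ S, e i ^ 2 ≤ S.card * maxSqBound s e := by
    rw [← nsmul_eq_mul]
    exact Finset.sum_le_card_nsmul _ _ _ fun i _ => sq_le_maxSqBound hs e i
  rw [div_pow, div_le_iff₀ (by positivity)]
  nlinarith

/-- The mass is at most $2N/n$ plus the excess. The first part cancels one factor $1/N$ of the
squared mean; in the second the squared mean is bounded by the largest squared noise. -/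
lemma cell_mass_mul_sq_mean_le {s : ℝ} (hs : 0 < s) {K : ℕ} (hn : 1 ≤ n) (hp : 1 ≤ p)
    (μ : Measure (Fin p → ℝ)) [IsProbabilityMeasure μ] (g : Fin p → Fin n → ℝ)
    (hg : ∀ (j : Fin p) (k : Fin n), 0 < (k : ℕ) → μ.real {u | u j ≤ g j k} = (k : ℝ) / n)
    (D : Dataset n p) (e : Fin n → ℝ) (f : Fin K → Option (Fin p × Bool × ℝ))
    (hne : (nodePoints D (halfBox f)).Nonempty) :
    μ.real (halfBox f) *
      ((∑ i ∈ nodePoints D (halfBox f), e i) / (nodePoints D (halfBox f)).card) ^ 2 ≤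
    2 / n * noiseBound s K (fun i => (D i).2, e) +
      massExcess μ g K (fun i => (D i).2) * maxSqBound s e := by
  have h1 := measureReal_halfBox_le hn hp μ g hg D f
  have h2 := sq_mean_le_maxSqBound hs e hne
  obtain ⟨c, hc⟩ := exists_nodePoints_eq_traceBox D f hne
  have h3 := sq_sum_div_card_le hs (K := K) hn hp (fun i => (D i).2) e c (hc ▸ hne)
  rw [← hc] at h3
  set S := nodePoints D (halfBox f)
  have hN : (0 : ℝ) < S.card := by exact_mod_cast hne.card_pos
  have h4 := massExcess_nonneg μ g K (fun i => (D i).2)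
  calc _ ≤ (2 * S.card / n + massExcess μ g K (fun i => (D i).2)) *
        ((∑ i ∈ S, e i) / S.card) ^ 2 := by gcongr
    _ = 2 / n * ((∑ i ∈ S, e i) ^ 2 / S.card) +
        massExcess μ g K (fun i => (D i).2) * ((∑ i ∈ S, e i) / S.card) ^ 2 := by
      field_simp
    _ ≤ _ := by gcongr

/-- The bound for the integrated squared error of a depth-`K` tree. -/
def treeErrorBound (s : ℝ) (μ : Measure (Fin p → ℝ)) (g : Fin p → Fin n → ℝ) (K : ℕ)
    (q : (Fin n → Fin p → ℝ) × (Fin n → ℝ)) : ℝ :=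
  2 ^ K * (2 / n * noiseBound s K q + massExcess μ g K q.1 * maxSqBound s q.2)

lemma noiseBound_nonneg {s : ℝ} {K : ℕ} (q : (Fin n → Fin p → ℝ) × (Fin n → ℝ)) :
    0 ≤ noiseBound s K q := by
  have h1 := boxEntropy_nonneg n p K
  have h2 := maxSqBound_nonneg s q.2
  have h3 : 0 ≤ noiseExp s K q := Finset.sum_nonneg fun c _ => (Real.exp_pos _).le
  unfold noiseBound
  positivity

lemma treeErrorBound_nonneg {s : ℝ} {μ : Measure (Fin p → ℝ)} {g : Fin p → Fin n → ℝ} {K : ℕ}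
    (q : (Fin n → Fin p → ℝ) × (Fin n → ℝ)) : 0 ≤ treeErrorBound s μ g K q := by
  have h1 := noiseBound_nonneg (s := s) (K := K) q
  have h2 := massExcess_nonneg μ g K q.1
  have h3 := maxSqBound_nonneg s q.2
  unfold treeErrorBound
  positivity

lemma lintegral_cartEstimate_le {s : ℝ} (hs : 0 < s) {K : ℕ} (hn : 1 ≤ n) (hp : 1 ≤ p)
    (μ : Measure (Fin p → ℝ)) [IsProbabilityMeasure μ] (g : Fin p → Fin n → ℝ)
    (hg : ∀ (j : Fin p) (k : Fin n), 0 < (k : ℕ) → μ.real {u | u j ≤ g j k} = (k : ℝ) / n)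
    {D : Dataset n p} {c : ℝ} {e : Fin n → ℝ} (he : ∀ i, (D i).1 = c + e i)
    {T : CartTree p} (hT : IsCartTree K D T) :
    ∫⁻ x, ENNReal.ofReal ((cartEstimate T D x - c) ^ 2) ∂μ ≤
      ENNReal.ofReal (treeErrorBound s μ g K (fun i => (D i).2, e)) := by
  set B := 2 / n * noiseBound s K (fun i => (D i).2, e) +
      massExcess μ g K (fun i => (D i).2) * maxSqBound s e with hB
  have h := CartTree.setLIntegral_cellFrom_le μ
    (fun t => ENNReal.ofReal (((∑ i ∈ nodePoints D t, e i) / (nodePoints D t).card) ^ 2))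
    (ENNReal.ofReal B) T Set.univ MeasurableSet.univ fun x _ => by
      have hne := hT.nonempty_cell hn x
      obtain ⟨f, hf⟩ := T.exists_cell_eq hT.1 x
      change μ (T.cell x) * ENNReal.ofReal (((∑ i ∈ nodePoints D (T.cell x), e i) /
        (nodePoints D (T.cell x)).card) ^ 2) ≤ _
      rw [hf] at hne ⊢
      rw [← ofReal_measureReal, ← ENNReal.ofReal_mul measureReal_nonneg]
      exact ENNReal.ofReal_le_ofReal (cell_mass_mul_sq_mean_le hs hn hp μ g hg D e f hne)
  rw [Measure.restrict_univ] at h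
  calc _ = _ := lintegral_congr fun x => by
        rw [cartEstimate_sub_eq he (hT.nonempty_cell hn x), CartTree.cell]
    _ ≤ _ := h
    _ ≤ 2 ^ K * ENNReal.ofReal B := by
      gcongr
      · exact one_le_two
      · exact hT.1
    _ = _ := by
      rw [treeErrorBound, ENNReal.ofReal_mul (by positivity), ENNReal.ofReal_pow (by norm_num)]
      simp [hB]

lemma lintegral_cartEstimate_le_maxSqBound {s : ℝ} (hs : 0 < s) {K : ℕ} (hn : 1 ≤ n)
    (μ : Measure (Fin p → ℝ)) [IsProbabilityMeasure μ]
    {D : Dataset n p} {c : ℝ} {e : Fin n → ℝ} (he : ∀ i, (D i).1 = c + e i)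
    {T : CartTree p} (hT : IsCartTree K D T) :
    ∫⁻ x, ENNReal.ofReal ((cartEstimate T D x - c) ^ 2) ∂μ ≤ ENNReal.ofReal (maxSqBound s e) := by
  calc _ ≤ ∫⁻ _x, ENNReal.ofReal (maxSqBound s e) ∂μ := lintegral_mono fun x => by
        rw [cartEstimate_sub_eq he (hT.nonempty_cell hn x)]
        exact ENNReal.ofReal_le_ofReal (sq_mean_le_maxSqBound hs e (hT.nonempty_cell hn x))
    _ = _ := by simp

lemma treeErrorBound_bound {ν : Measure ℝ} [IsProbabilityMeasure ν] (μ : Measure (Fin p → ℝ))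
    [IsProbabilityMeasure μ] (g : Fin p → Fin n → ℝ) {s : ℝ} {K : ℕ} (hn : 1 ≤ n) (hp : 1 ≤ p)
    (hs : 0 < s) (hmean : ∫ e, e ∂ν = 0)
    (hint : Integrable (fun e : ℝ => Real.exp (|e| / s)) ν)
    (hle : ∫ e, Real.exp (|e| / s) ∂ν ≤ 2) :
    Integrable (treeErrorBound s μ g K)
      ((Measure.pi fun _ : Fin n => μ).prod (Measure.pi fun _ : Fin n => ν)) ∧
    ∫ q, treeErrorBound s μ g K q
      ∂((Measure.pi fun _ : Fin n => μ).prod (Measure.pi fun _ : Fin n => ν)) ≤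
      2 ^ K * (boxEntropy n p K / n) * s ^ 2 * (28 * Real.log (2 * n) ^ 2 + 920) := by
  obtain ⟨i1, b1⟩ := maxSqBound_bound hn hint hle
  obtain ⟨i2, b2⟩ := massExcess_bound (K := K) hn hp μ g
  obtain ⟨i3, b3⟩ := noiseBound_bound (K := K) μ hn hp hs hmean hint hle
  have i4 := i2.mul_prod i1
  refine ⟨((i3.const_mul _).add i4).const_mul _, ?_⟩
  unfold treeErrorBound
  -- The mass excess depends on the covariates only and the noise maximum on the noise only, so the
  -- expectation of their product factorises.
  rw [integral_const_mul, integral_add (i3.const_mul _) i4, integral_const_mul,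
    integral_prod_mul (massExcess μ g K) (maxSqBound s)]
  have h1 : 0 ≤ ∫ e, maxSqBound s e ∂(Measure.pi fun _ : Fin n => ν) :=
    integral_nonneg fun e => maxSqBound_nonneg s e
  have hL := boxEntropy_nonneg n p K
  calc _ ≤ 2 ^ K * (2 / n * (s ^ 2 * boxEntropy n p K * (4 * Real.log (2 * n) ^ 2 + 440)) +
        5 * boxEntropy n p K / n * (s ^ 2 * (4 * Real.log (2 * n) ^ 2 + 8))) := by gcongr
    _ = _ := by ring

end CellBounds

lemma nssError_nonneg {n p : ℕ} {Ω : Type*} (X : Fin n → Ω → (Fin p → ℝ)) (y : Fin n → Ω → ℝ)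
    (T : Ω → CartTree p) (c : ℝ) (PX : Measure (Fin p → ℝ)) (ω : Ω) :
    0 ≤ nssError X y T c PX ω :=
  integral_nonneg fun _ => sq_nonneg _

/-! ### Transfer to the regression model, and the rate. -/

section Model

variable {n p : ℕ} {Ω : Type*} [MeasurableSpace Ω] {P : Measure Ω}
  {X : Fin n → Ω → (Fin p → ℝ)} {ε y : Fin n → Ω → ℝ} {c : ℝ}
  {PX : Measure (Fin p → ℝ)} {ν : Measure ℝ}

lemma IsLocationModel.measurePreserving (h : IsLocationModel P X ε y c PX ν)
    [IsProbabilityMeasure ν] :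
    MeasurePreserving (fun ω => ((fun i => X i ω, fun i => ε i ω) :
      (Fin n → Fin p → ℝ) × (Fin n → ℝ))) P
      ((Measure.pi fun _ => PX).prod (Measure.pi fun _ => ν)) := by
  have := h.isProbabilityMeasure
  have := h.isProbabilityMeasure_PX
  have hX := h.measurable_X
  have hε := h.measurable_noise
  have hpair : ∀ i, Measurable fun ω => (X i ω, ε i ω) := fun i => (hX i).prodMk (hε i)
  have hind : iIndepFun (fun i ω => (X i ω, ε i ω)) P := by
    have := h.indep_sample.comp (fun _ (q : ℝ × (Fin p → ℝ)) => (q.2, q.1 - c))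
      fun _ => by fun_prop
    convert this using 3 with i ω
    simp [h.outcome]
  have hlaw : ∀ i, P.map (fun ω => (X i ω, ε i ω)) = PX.prod ν := by
    intro i
    rw [(indepFun_iff_map_prod_eq_prod_map_map (hX i).aemeasurable (hε i).aemeasurable).1
      (h.indep_noise i), h.law_X, h.law_noise]
  have hmp : MeasurePreserving (fun ω i => (X i ω, ε i ω)) P
      (Measure.pi fun _ : Fin n => PX.prod ν) := by
    refine ⟨measurable_pi_lambda _ hpair, ?_⟩
    rw [(iIndepFun_iff_map_fun_eq_pi_map fun i => (hpair i).aemeasurable).1 hind]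
    simp_rw [hlaw]
  exact (measurePreserving_arrowProdEquivProdArrow (Fin p → ℝ) ℝ (Fin n) (fun _ => PX)
    (fun _ => ν)).comp hmp

variable {K : ℕ} {T : Ω → CartTree p}

lemma IsNSSCart.stronglyMeasurable_nssError [SFinite PX] (hT : IsNSSCart P K X y T) :
    StronglyMeasurable (nssError X y T c PX) :=
  ((hT.measurable_estimate.sub_const c).pow_const 2).stronglyMeasurable.integral_prod_right'

lemma IsNSSCart.nssError_eq_toReal (hT : IsNSSCart P K X y T) (ω : Ω) :
    nssError X y T c PX ω =
      (∫⁻ x, ENNReal.ofReal ((cartEstimate (T ω) (sample X y ω) x - c) ^ 2) ∂PX).toReal :=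
  integral_eq_lintegral_of_nonneg_ae (ae_of_all _ fun _ => sq_nonneg _)
    (((hT.measurable_estimate.comp measurable_prodMk_left).sub_const c).pow_const
      2).aestronglyMeasurable

/-- A deterministic bound $H$, valid for every CART tree on the data, is integrated against the
product law of covariates and noise given by `IsLocationModel.measurePreserving`. -/
lemma IsNSSCart.integral_nssError_le_of_bound (h : IsLocationModel P X ε y c PX ν)
    [IsProbabilityMeasure ν] (hT : IsNSSCart P K X y T)
    {H : (Fin n → Fin p → ℝ) × (Fin n → ℝ) → ℝ} (hH0 : ∀ q, 0 ≤ H q)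
    (hH : Integrable H ((Measure.pi fun _ => PX).prod (Measure.pi fun _ => ν)))
    (hle : ∀ ω, IsCartTree K (sample X y ω) (T ω) →
      ∫⁻ x, ENNReal.ofReal ((cartEstimate (T ω) (sample X y ω) x - c) ^ 2) ∂PX ≤
        ENNReal.ofReal (H (fun i => X i ω, fun i => ε i ω))) :
    Integrable (nssError X y T c PX) P ∧ ∫ ω, nssError X y T c PX ω ∂P ≤
      ∫ q, H q ∂((Measure.pi fun _ => PX).prod (Measure.pi fun _ => ν)) := by
  have := h.isProbabilityMeasure_PX
  have hmp := h.measurePreserving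
  have hHi := hmp.integrable_comp_of_integrable hH
  have hpt : ∀ᵐ ω ∂P, nssError X y T c PX ω ≤ H (fun i => X i ω, fun i => ε i ω) := by
    filter_upwards [hT.isCartTree] with ω hω
    rw [hT.nssError_eq_toReal]
    exact ENNReal.toReal_le_of_le_ofReal (hH0 _) (hle ω hω)
  have hi : Integrable (nssError X y T c PX) P := by
    refine hHi.mono' hT.stronglyMeasurable_nssError.aestronglyMeasurable ?_
    filter_upwards [hpt] with ω hω
    rw [Real.norm_eq_abs, abs_of_nonneg (nssError_nonneg X y T c PX ω)]
    exact hω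
  refine ⟨hi, (integral_mono_ae hi hHi hpt).trans_eq ?_⟩
  have hm : AEStronglyMeasurable H (P.map fun ω => ((fun i => X i ω, fun i => ε i ω) :
      (Fin n → Fin p → ℝ) × (Fin n → ℝ))) := by rw [hmp.map_eq]; exact hH.aestronglyMeasurable
  rw [← hmp.map_eq, integral_map hmp.measurable.aemeasurable hm]
  rfl

lemma log_codes_le (hn : 2 ≤ n) (hp : 1 ≤ p) :
    Real.log (1 + 2 * p * n) ≤ 3 * Real.log (n * p) := by
  have hn' : (2 : ℝ) ≤ n := by exact_mod_cast hn
  have hp' : (1 : ℝ) ≤ p := by exact_mod_cast hp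
  have hm : (2 : ℝ) ≤ n * p := by nlinarith
  have h : (3 : ℝ) * Real.log (n * p) = Real.log ((n * p) ^ 3) := by
    rw [Real.log_pow]; norm_num
  rw [h]
  apply Real.log_le_log (by positivity)
  have : 1 + 2 * (p : ℝ) * n = 1 + 2 * (n * p) := by ring
  rw [this]
  set m : ℝ := n * p
  nlinarith [mul_nonneg (sub_nonneg.2 hm) (sub_nonneg.2 hm), pow_nonneg (by linarith : 0 ≤ m) 2]

lemma log_bounds (hn : 2 ≤ n) : 0.69 ≤ Real.log n ∧ Real.log (2 * n) ≤ 2 * Real.log n := by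
  have hn' : (2 : ℝ) ≤ n := by exact_mod_cast hn
  have h : Real.log 2 ≤ Real.log n := Real.log_le_log (by norm_num) hn'
  refine ⟨by linarith [Real.log_two_gt_d9], ?_⟩
  rw [Real.log_mul (by norm_num) (by positivity)]
  linarith

lemma log_le_log_mul (hn : 2 ≤ n) (hp : 1 ≤ p) : Real.log n ≤ Real.log (n * p) := by
  have hn' : (2 : ℝ) ≤ n := by exact_mod_cast hn
  have hp' : (1 : ℝ) ≤ p := by exact_mod_cast hp
  exact Real.log_le_log (by positivity) (by nlinarith)

lemma cartRate_pos (hn : 2 ≤ n) (hp : 1 ≤ p) (K : ℕ) : 0 < cartRate n p K := by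
  have h1 := (log_bounds hn).1
  have h2 := log_le_log_mul hn hp
  have h3 : 0 < Real.log n := by linarith
  have h4 : 0 < Real.log (n * p) := by linarith
  have : (0 : ℝ) < n := by exact_mod_cast (by omega : 0 < n)
  unfold cartRate
  positivity

/-- The expected integrated squared error is smaller than the rate by a factor `log n`. -/
lemma IsNSSCart.integral_nssError_le (h : IsLocationModel P X ε y c PX ν)
    [IsProbabilityMeasure ν] (hT : IsNSSCart P K X y T) (hn : 2 ≤ n) (hp : 1 ≤ p)
    {s : ℝ} (hs : 0 < s) (hmean : ∫ e, e ∂ν = 0)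
    (hint : Integrable (fun e : ℝ => Real.exp (|e| / s)) ν)
    (hle : ∫ e, Real.exp (|e| / s) ∂ν ≤ 2) :
    Integrable (nssError X y T c PX) P ∧ ∫ ω, nssError X y T c PX ω ∂P ≤
      20000 * s ^ 2 / Real.log n * cartRate n p K := by
  have := h.isProbabilityMeasure_PX
  have hn1 : 1 ≤ n := by omega
  have hn0 : (0 : ℝ) < n := by exact_mod_cast hn1
  have hout : ∀ ω i, (sample X y ω i).1 = c + ε i ω := fun ω i => h.outcome i ω
  obtain ⟨hl, hl2⟩ := log_bounds hn
  have hlp := log_le_log_mul hn hp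
  have hl20 : 0 ≤ Real.log (2 * n) := Real.log_nonneg (by
    have : (1 : ℝ) ≤ n := by exact_mod_cast hn1
    linarith)
  have hK0 : (0 : ℝ) ≤ K := Nat.cast_nonneg K
  set l := Real.log n with hldef
  have hl0 : 0 < l := by linarith
  have hrate : 20000 * s ^ 2 / l * cartRate n p K =
      20000 * s ^ 2 * (2 ^ K / n * (l ^ 3 * Real.log (n * p))) := by
    rw [cartRate, ← hldef]; field_simp
  have hsq : Real.log (2 * n) ^ 2 ≤ 4 * l ^ 2 := by nlinarith
  have hlsq : 0.476 ≤ l ^ 2 := by nlinarith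
  rw [hrate]
  -- When $2^K\ge n$ the factor $2^K/n$ of the rate is at least $1$, so the expected largest squared
  -- noise, $O(\log^2 n)$, suffices. Otherwise $K\log 2\le\log n$ turns the factor $K+1$ of the
  -- entropy into one $\log n$.
  by_cases hKn : (n : ℝ) ≤ 2 ^ K
  · obtain ⟨i1, b1⟩ := maxSqBound_bound hn1 hint hle
    obtain ⟨hi, hb⟩ := hT.integral_nssError_le_of_bound h
      (H := fun q => maxSqBound s q.2) (fun q => maxSqBound_nonneg s q.2)
      (i1.comp_snd (μ := Measure.pi fun _ => PX)) fun ω hω =>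
        lintegral_cartEstimate_le_maxSqBound hs hn1 PX (hout ω) hω
    refine ⟨hi, hb.trans ?_⟩
    rw [integral_fun_snd (maxSqBound s), probReal_univ, one_smul]
    refine b1.trans ?_
    have hratio : 1 ≤ (2 : ℝ) ^ K / n := by rwa [le_div_iff₀ hn0, one_mul]
    have hll : 0.476 * l ^ 2 ≤ l ^ 3 * Real.log (n * p) := by
      calc 0.476 * l ^ 2 ≤ l ^ 2 * l ^ 2 := by gcongr
        _ = l ^ 3 * l := by ring
        _ ≤ _ := by gcongr
    have h3 : 4 * Real.log (2 * n) ^ 2 + 8 ≤ 20000 * (1 * (0.476 * l ^ 2)) := by linarith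
    calc s ^ 2 * (4 * Real.log (2 * n) ^ 2 + 8)
        ≤ s ^ 2 * (20000 * (1 * (0.476 * l ^ 2))) := by gcongr
      _ = 20000 * s ^ 2 * (1 * (0.476 * l ^ 2)) := by ring
      _ ≤ _ := by gcongr
  · push Not at hKn
    obtain ⟨g, hg⟩ := exists_quantileGrid PX h.continuous_coordinates n
    obtain ⟨i1, b1⟩ := treeErrorBound_bound (K := K) PX g hn1 hp hs hmean hint hle
    obtain ⟨hi, hb⟩ := hT.integral_nssError_le_of_bound h
      (H := treeErrorBound s PX g K) treeErrorBound_nonneg i1 fun ω hω =>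
        lintegral_cartEstimate_le hs hn1 hp PX g hg (hout ω) hω
    refine ⟨hi, (hb.trans b1).trans ?_⟩
    have hKl : (K : ℝ) * Real.log 2 ≤ l := by
      rw [← Real.log_pow]
      exact Real.log_le_log (by positivity) hKn.le
    have hK3 : (K : ℝ) + 1 ≤ 3 * l := by nlinarith [Real.log_two_gt_d9]
    have hL : boxEntropy n p K ≤ 3 * l * (3 * Real.log (n * p)) := by
      unfold boxEntropy
      have := one_le_log_codes hn1 hp
      have := log_codes_le hn hp
      gcongr
    have h4 : 28 * Real.log (2 * n) ^ 2 + 920 ≤ 2050 * l ^ 2 := by linarith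
    have hlp0 : 0 ≤ Real.log (n * p) := by linarith
    calc _ ≤ 2 ^ K * (3 * l * (3 * Real.log (n * p)) / n) * s ^ 2 * (2050 * l ^ 2) := by gcongr
      _ = 18450 * (s ^ 2 * (2 ^ K / n * (l ^ 3 * Real.log (n * p)))) := by ring
      _ ≤ 20000 * (s ^ 2 * (2 ^ K / n * (l ^ 3 * Real.log (n * p)))) := by
        gcongr
        norm_num
      _ = _ := by ring

lemma IsNSSCart.measureReal_cartRate_le_nssError_le (h : IsLocationModel P X ε y c PX ν)
    [IsProbabilityMeasure ν] (hT : IsNSSCart P K X y T) (hn : 2 ≤ n) (hp : 1 ≤ p)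
    {s : ℝ} (hs : 0 < s) (hmean : ∫ e, e ∂ν = 0)
    (hint : Integrable (fun e : ℝ => Real.exp (|e| / s)) ν)
    (hle : ∫ e, Real.exp (|e| / s) ∂ν ≤ 2) :
    P.real {ω | cartRate n p K ≤ nssError X y T c PX ω} ≤ 20000 * s ^ 2 / Real.log n := by
  obtain ⟨hi, hb⟩ := hT.integral_nssError_le h hn hp hs hmean hint hle
  have hr := cartRate_pos hn hp K
  -- Markov's inequality at the level of the rate: the probability inherits the spare factor $1/\log
  -- n$.
  have hm := mul_meas_ge_le_integral_of_nonneg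
    (ae_of_all P (nssError_nonneg X y T c PX)) hi
    (cartRate n p K)
  have := hm.trans hb
  rw [mul_comm] at this
  exact le_of_mul_le_mul_right this hr

end Model

end

theorem mainTheorem4 :
    ∃ C : ℝ → ℝ, (∀ s, 0 < C s) ∧
      ∀ ν : Measure ℝ, IsNoiseLaw ν →
        (∀ (Ω : Type u) [MeasurableSpace Ω] (P : Measure Ω) (n p K : ℕ)
            (X : Fin n → Ω → (Fin p → ℝ)) (ε y : Fin n → Ω → ℝ) (c : ℝ)
            (PX : Measure (Fin p → ℝ)) (T : Ω → CartTree p),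
            2 ≤ n → 1 ≤ p →
            IsLocationModel P X ε y c PX ν →
            IsNSSCart P K X y T →
              Integrable (nssError X y T c PX) P ∧
              ∫ ω, nssError X y T c PX ω ∂P ≤ C (psiOneNorm ν) * cartRate n p K) ∧
        ∃ C' : ℝ, 0 < C' ∧
          ∀ (Ω : ℕ → Type u) [∀ n, MeasurableSpace (Ω n)] (P : ∀ n, Measure (Ω n))
            (p K : ℕ → ℕ)
            (X : ∀ n, Fin n → Ω n → (Fin (p n) → ℝ)) (ε y : ∀ n, Fin n → Ω n → ℝ) (c : ℕ → ℝ)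
            (PX : ∀ n, Measure (Fin (p n) → ℝ)) (T : ∀ n, Ω n → CartTree (p n)),
            (∀ n, 1 ≤ p n) →
            (∀ n, IsLocationModel (P n) (X n) (ε n) (y n) (c n) (PX n) ν) →
            (∀ n, IsNSSCart (P n) (K n) (X n) (y n) (T n)) →
              limsup (fun n => P n {ω | C' * cartRate n (p n) (K n) ≤
                nssError (X n) (y n) (T n) (c n) (PX n) ω}) atTop = 0 := by
  -- The Orlicz scale is taken as $|\psi|+1$, strictly above the norm $\psi$, so the infimum need
  -- not be attained. The constant doubles $20000$ because $\log n\ge 1/2$ for $n\ge 2$.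
  refine ⟨fun s => 40000 * (|s| + 1) ^ 2, fun s => by positivity, fun ν hν => ?_⟩
  have := hν.isProbabilityMeasure
  have hpos : 0 < |psiOneNorm ν| + 1 := by positivity
  obtain ⟨hint, hle⟩ := orlicz_of_psiOneNorm_lt hν
    (show psiOneNorm ν < |psiOneNorm ν| + 1 by linarith [le_abs_self (psiOneNorm ν)])
  set s := |psiOneNorm ν| + 1
  -- Since the expected error is $O(1/\log n)$ times the rate, $C'=1$ already works.
  refine ⟨?_, 1, one_pos, ?_⟩
  · intro Ω _ P n p K X ε y c PX T hn hp hM hT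
    obtain ⟨hi, hb⟩ := hT.integral_nssError_le hM hn hp hpos hν.mean_zero hint hle
    refine ⟨hi, hb.trans ?_⟩
    have hr := cartRate_pos hn hp K
    have hl := (log_bounds hn).1
    gcongr
    rw [div_le_iff₀ (by linarith)]
    nlinarith [sq_nonneg s]
  · intro Ω _ P p K X ε y c PX T hp hM hT
    refine Tendsto.limsup_eq ?_
    have hlim : Tendsto (fun n : ℕ => ENNReal.ofReal (20000 * s ^ 2 / Real.log n)) atTop
        (nhds 0) := by
      rw [← ENNReal.ofReal_zero]
      exact ENNReal.tendsto_ofReal (tendsto_const_nhds.div_atTop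
        (Real.tendsto_log_atTop.comp tendsto_natCast_atTop_atTop))
    refine tendsto_of_tendsto_of_tendsto_of_le_of_le' tendsto_const_nhds hlim
      (Eventually.of_forall fun n => zero_le) ?_
    filter_upwards [eventually_ge_atTop 2] with n hn
    have := (hM n).isProbabilityMeasure
    simp only [one_mul]
    rw [← ofReal_measureReal]
    exact ENNReal.ofReal_le_ofReal ((hT n).measureReal_cartRate_le_nssError_le (hM n) hn (hp n)
      hpos hν.mean_zero hint hle)
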